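/- Let $V$ and $H$ be real Hilbert spaces forming a Gelfand triple $V\hookrightarrow_c H\cong H^*\hookrightarrow V^*$: $V$ is densely, continuously and compactly embedded in $H$. The norms are normalised so that $\|v\|_H\le\|v\|_V$ for all $v\in V$. Let $a\colon V\times V\to\mathbb R$ be a continuous bilinear form with $a(v,v)\ge\alpha_0\|v\|_V^2$ for all $v\in V$ and some $\alpha_0>0$ (Gårding's inequality with $\omega_0=0$), and let $A\colon V\to V^*$ be defined by $\langle Ay,v\rangle=a(y,v)$. Let $(\omega,\varrho)$ be a measure space, $B\colon L^2(\omega)\to V^*$ linear and continuous, and $u_a,u_b\in L^\infty(\omega)$ with $u_a<u_b$ a.e. Set $$U_{ad}=\{u\in L^2(\omega): u_a\le u\le u_b \text{ a.e. in }\omega\},$$ $$U_{ad}(0,T)=\{u\in L^2((0,T);L^2(\omega)): u(t)\in U_{ad}\text{ for a.e. }t\in(0,T)\}.$$ Let $y_0\in H$, $y_d\in V$ and $\delta_0>0$. For $T>0$ and $u\in U_{ad}(0,T)$ let $y[u]\in W(0,T)=L^2((0,T);V)\cap H^1((0,T);V^*)\hookrightarrow C([0,T];H)$ be the solution of $$\partial_t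 y+Ay=Bu\ \text{ in }(0,T),\qquad y(0)=y_0 .$$ Assume that $\|y_0-y_d\|_H>\delta_0$ and that there are $T>0$ and $u\in U_{ad}(0,T)$ with $\|y[u](T)-y_d\|_H\le\delta_0$. For $\delta\ge 0$ define $$T(\delta)=\inf\{T>0:\ \exists\,u\in U_{ad}(0,T)\text{ with }\|y[u](T)-y_d\|_H\le\delta_0+\delta\}\in[0,\infty],$$ and set $\delta^\bullet=\|y_0-y_d\|_H-\delta_0$. If there is $\breve u\in U_{ad}$ with $\|B\breve u-Ay_d\|_{V^*}<\alpha_0\delta_0$, then $T(\cdot)$ is finite on $[0,\delta^\bullet]$ and Lipschitz continuous from the left there: there is a constant $L\ge0$ such that $$|T(\delta')-T(\delta)|\le L\,(\delta-\delta')\qquad\text{for all }0\le\delta'\le\delta\le\delta^\bullet .$$ -/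

import Mathlib

open MeasureTheory Set
open scoped ENNReal ContDiff InnerProductSpace

noncomputable section

namespace TimeOptimal

variable {V H Ω : Type*}
  [NormedAddCommGroup V] [InnerProductSpace ℝ V]
  [NormedAddCommGroup H] [InnerProductSpace ℝ H]
  [MeasurableSpace Ω]

/-- The map `ι : V → H` realises a Gelfand triple `V ↪ H ≅ H* ↪ V*`: it is a compact
injective linear map with dense range. -/
structure IsGelfandTriple (ι : V →L[ℝ] H) : Prop where
  injective : Function.Injective ι
  denseRange : DenseRange ι
  compact : IsCompactOperator ι

/-- The embedding `H ≅ H* ↪ V*`, `h ↦ (v ↦ (h, ι v)_H)`. -/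
def toDual (ι : V →L[ℝ] H) (h : H) : StrongDual ℝ V :=
  (innerSL ℝ h).comp ι

/-- Gårding's inequality `a(v,v) + ω₀ ‖v‖_H² ≥ α₀ ‖v‖_V²` for all `v ∈ V`. -/
def Garding (ι : V →L[ℝ] H) (a : V →L[ℝ] V →L[ℝ] ℝ) (α₀ ω₀ : ℝ) : Prop :=
  ∀ v : V, a v v + ω₀ * ‖ι v‖ ^ 2 ≥ α₀ * ‖v‖ ^ 2

/-- The operator `A : V → V*` given by `⟨A y, v⟩ = a(y, v)`. -/
def opA (a : V →L[ℝ] V →L[ℝ] ℝ) : V →L[ℝ] StrongDual ℝ V := a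

/-- `g` is the weak (distributional) derivative of `f` on the interval `(0,T)`. -/
def HasWeakDerivOn {X : Type*} [NormedAddCommGroup X] [NormedSpace ℝ X]
    (T : ℝ) (f g : ℝ → X) : Prop :=
  ∀ φ : ℝ → ℝ, ContDiff ℝ ∞ φ → HasCompactSupport φ → tsupport φ ⊆ Ioo 0 T →
    ∫ t in Ioo 0 T, deriv φ t • f t = - ∫ t in Ioo 0 T, φ t • g t

/-- `y` belongs to `W(0,T) = L²((0,T); V) ∩ H¹((0,T); V*)` and `y'` is its time derivative. -/
structure MemW (ι : V →L[ℝ] H) (T : ℝ) (y : ℝ → V) (y' : ℝ → StrongDual ℝ V) : Prop where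
  memLp : MemLp y 2 (volume.restrict (Ioo 0 T))
  memLp_deriv : MemLp y' 2 (volume.restrict (Ioo 0 T))
  weakDeriv : HasWeakDerivOn T (fun t => toDual ι (ι (y t))) y'

/-- `Y` is, on `[0,T]`, the representative of `y` in `C([0,T]; H)`.
Its values are the traces of `y`. -/
structure IsContRep (ι : V →L[ℝ] H) (T : ℝ) (y : ℝ → V) (Y : ℝ → H) : Prop where
  continuousOn : ContinuousOn Y (Icc 0 T)
  ae_eq : ∀ᵐ t ∂(volume.restrict (Ioo 0 T)), Y t = ι (y t)

/-- `Y : [0,T] → H` is the trajectory `y[u]` (as an element of `C([0,T]; H)`) of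
`∂ₜ y + A y = B u` on `(0,T)` with `y(0) = y₀`, where the solution is sought in `W(0,T)`. -/
def IsTrajectory (ι : V →L[ℝ] H) (a : V →L[ℝ] V →L[ℝ] ℝ) {ρ : Measure Ω}
    (B : Lp ℝ 2 ρ →L[ℝ] StrongDual ℝ V) (y₀ : H) (T : ℝ) (u : ℝ → Lp ℝ 2 ρ)
    (Y : ℝ → H) : Prop :=
  ∃ (y : ℝ → V) (y' : ℝ → StrongDual ℝ V),
    MemW ι T y y' ∧ IsContRep ι T y Y ∧
    (∀ᵐ t ∂(volume.restrict (Ioo 0 T)), y' t + opA a (y t) = B (u t)) ∧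
    Y 0 = y₀

/-- `U_ad = {u ∈ L²(ω) : u_a ≤ u ≤ u_b a.e. in ω}`. -/
def Uad (ρ : Measure Ω) (ua ub : Ω → ℝ) : Set (Lp ℝ 2 ρ) :=
  {u | ∀ᵐ x ∂ρ, ua x ≤ u x ∧ u x ≤ ub x}

/-- `U_ad(0,T) = {u ∈ L²((0,T); L²(ω)) : u(t) ∈ U_ad for a.e. t ∈ (0,T)}`. -/
def UadTime (ρ : Measure Ω) (ua ub : Ω → ℝ) (T : ℝ) : Set (ℝ → Lp ℝ 2 ρ) :=
  {u | MemLp u 2 (volume.restrict (Ioo 0 T)) ∧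
    ∀ᵐ t ∂(volume.restrict (Ioo 0 T)), u t ∈ Uad ρ ua ub}

/-- The times `T > 0` for which some `u ∈ U_ad(0,T)` satisfies `‖y[u](T) - y_d‖_H ≤ r`. -/
def feasibleTimes (ι : V →L[ℝ] H) (a : V →L[ℝ] V →L[ℝ] ℝ) {ρ : Measure Ω}
    (B : Lp ℝ 2 ρ →L[ℝ] StrongDual ℝ V) (ua ub : Ω → ℝ) (y₀ yd : H) (r : ℝ) : Set ℝ :=
  {T | 0 < T ∧ ∃ u ∈ UadTime ρ ua ub T, ∃ Y : ℝ → H,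
    IsTrajectory ι a B y₀ T u Y ∧ ‖Y T - yd‖ ≤ r}

/-- The value function `T(δ) ∈ [0,∞]`: the infimum of all `T > 0` for which some
`u ∈ U_ad(0,T)` satisfies `‖y[u](T) - y_d‖_H ≤ δ₀ + δ`. -/
def minTime (ι : V →L[ℝ] H) (a : V →L[ℝ] V →L[ℝ] ℝ) {ρ : Measure Ω}
    (B : Lp ℝ 2 ρ →L[ℝ] StrongDual ℝ V) (ua ub : Ω → ℝ) (y₀ yd : H) (δ₀ δ : ℝ) : ℝ≥0∞ :=
  ⨅ T ∈ feasibleTimes ι a B ua ub y₀ yd (δ₀ + δ), ENNReal.ofReal T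

/-- `f` is Lipschitz continuous from the left on `s`, with a constant that is uniform on `s`. -/
def LipschitzFromLeftOn (f : ℝ → ℝ) (s : Set ℝ) : Prop :=
  ∃ L : ℝ, 0 ≤ L ∧ ∀ δ ∈ s, ∀ δ' ∈ s, δ' ≤ δ → |f δ' - f δ| ≤ L * (δ - δ')

end TimeOptimal

end

/-! Suppose a control brings the state within `δ₀ + δ` of `yd` at time `T`; continue it with the
constant control `k` = ŭ. With e = y - yd, (1/2) d/dt ‖e‖_H² = ⟨B k - A yd, e⟩ - a(e, e) ≤ ‖e‖_V (‖B
k - A yd‖ - α₀ ‖e‖_V). While ‖e‖_H ≥ δ₀, also ‖e‖_V ≥ δ₀, so the strict hypothesis on ŭ leaves a κ >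
0 for which the right side is at most -κ ‖e‖_H: the distance shrinks with speed at least κ. An extra
time (δ - δ')/κ brings it down to `δ₀ + δ'` (`add_mem_feasibleTimes`), whence T(δ') ≤ T(δ) + (δ -
δ')/κ. The reverse bound T(δ) ≤ T(δ') is monotonicity.

The work lies in exhibiting the continuation as a weak solution. If A w = B k, then y - w solves the
homogeneous equation. For initial values in the domain of the part of A in H it is a limit of Yosida
approximations (`exists_isClassical`), regular enough to differentiate the distance pointwise
(`IsClassical.norm_add_sub_le`). Density and the energy inequality extend existence and decay to
initial values in H (`exists_isIntegrated`). The pieces are joined in integrated form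
(`IsTrajectory.glue`), with du Bois-Reymond translating weak derivatives into primitives. Uniqueness
is not needed: a time is feasible as soon as some trajectory exists. -/

namespace TimeOptimal

open Filter Topology

/-! ### Stationary problem: Lax–Milgram, resolvents, density of the domain. -/

section Stationary

variable {V H : Type*}
  [NormedAddCommGroup V] [InnerProductSpace ℝ V]
  [NormedAddCommGroup H] [InnerProductSpace ℝ H]

/-- `toDual` as a continuous linear map. -/
noncomputable def toDualL (ι : V →L[ℝ] H) : H →L[ℝ] StrongDual ℝ V :=
  ((ContinuousLinearMap.compL ℝ V H ℝ).flip ι).comp (innerSL ℝ)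

theorem toDual_apply (ι : V →L[ℝ] H) (h : H) (w : V) : toDual ι h w = ⟪h, ι w⟫_ℝ := rfl

theorem toDual_sub (ι : V →L[ℝ] H) (h k : H) :
    toDual ι (h - k) = toDual ι h - toDual ι k := (toDualL ι).map_sub h k

theorem toDual_add (ι : V →L[ℝ] H) (h k : H) :
    toDual ι (h + k) = toDual ι h + toDual ι k := (toDualL ι).map_add h k

/-- **Lax–Milgram**: a coercive form represents every functional. -/
theorem exists_eq_of_coercive [CompleteSpace V] {a : V →L[ℝ] V →L[ℝ] ℝ} {α : ℝ} (hα : 0 < α)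
    (ha : ∀ v, α * ‖v‖ ^ 2 ≤ a v v) (f : StrongDual ℝ V) : ∃ w, a w = f := by
  have hc : IsCoercive a := ⟨α, hα, fun v => by have := ha v; nlinarith⟩
  refine ⟨hc.continuousLinearEquivOfBilin.symm ((InnerProductSpace.toDual ℝ V).symm f), ?_⟩
  ext w
  rw [← hc.continuousLinearEquivOfBilin_apply]
  simp

/-- The resolvent of the operator associated with a coercive form. -/
theorem exists_resolvent [CompleteSpace V] [CompleteSpace H] (ι : V →L[ℝ] H)
    {a : V →L[ℝ] V →L[ℝ] ℝ} {α : ℝ} (hα : 0 < α)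
    (ha : ∀ v, α * ‖v‖ ^ 2 ≤ a v v) {l : ℝ} (hl : 0 < l) :
    ∃ R : H →L[ℝ] V, ∀ h w, ⟪ι (R h), ι w⟫_ℝ + l * a (R h) w = ⟪h, ι w⟫_ℝ := by
  let b : V →L[ℝ] V →L[ℝ] ℝ := (toDualL ι).comp ι + l • a
  have hb : ∀ v w, b v w = ⟪ι v, ι w⟫_ℝ + l * a v w := fun v w => rfl
  have hc : IsCoercive b := by
    refine ⟨l * α, by positivity, fun v => ?_⟩
    have h1 : 0 ≤ ⟪ι v, ι v⟫_ℝ := real_inner_self_nonneg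
    have h2 := mul_le_mul_of_nonneg_left (ha v) hl.le
    rw [hb]
    nlinarith
  refine ⟨(hc.continuousLinearEquivOfBilin.symm : V →L[ℝ] V).comp (ContinuousLinearMap.adjoint ι),
    fun h w => ?_⟩
  rw [← hb, ← hc.continuousLinearEquivOfBilin_apply]
  simp [ContinuousLinearMap.adjoint_inner_left]

/-- A vector `v` lies in the domain of the part of `A` in `H`, with image `g`. -/
def IsStrong (ι : V →L[ℝ] H) (a : V →L[ℝ] V →L[ℝ] ℝ) (v : V) (g : H) : Prop :=
  ∀ w, a v w = ⟪g, ι w⟫_ℝ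

theorem isStrong_resolvent {ι : V →L[ℝ] H} {a : V →L[ℝ] V →L[ℝ] ℝ} {l : ℝ} (hl : 0 < l)
    {R : H →L[ℝ] V} (hR : ∀ h w, ⟪ι (R h), ι w⟫_ℝ + l * a (R h) w = ⟪h, ι w⟫_ℝ) (h : H) :
    IsStrong ι a (R h) (l⁻¹ • (h - ι (R h))) := by
  intro w
  rw [real_inner_smul_left, inner_sub_left, ← hR h w]
  field_simp
  ring

/-- Testing monotonicity with `v - R (ι v)` gives `0 ≤ l * ⟪g - p, p⟫` for the Yosida value `p`. The
resulting bound is uniform in `l`. -/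
theorem norm_yosida_le {ι : V →L[ℝ] H} {a : V →L[ℝ] V →L[ℝ] ℝ} (ha : ∀ v, 0 ≤ a v v)
    {l : ℝ} (hl : 0 < l) {R : H →L[ℝ] V}
    (hR : ∀ h w, ⟪ι (R h), ι w⟫_ℝ + l * a (R h) w = ⟪h, ι w⟫_ℝ) {v : V} {g : H}
    (hv : IsStrong ι a v g) : ‖l⁻¹ • (ι v - ι (R (ι v)))‖ ≤ ‖g‖ := by
  set p := l⁻¹ • (ι v - ι (R (ι v))) with hp
  have h1 : ι (v - R (ι v)) = l • p := by rw [hp, smul_inv_smul₀ hl.ne', map_sub]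
  have h2 : a (v - R (ι v)) (v - R (ι v)) = ⟪g - p, l • p⟫_ℝ := by
    rw [map_sub a, sub_apply, hv, isStrong_resolvent hl hR (ι v), ← hp,
      ← inner_sub_left, h1]
  have h3 := ha (v - R (ι v))
  rw [h2, real_inner_smul_right, inner_sub_left, real_inner_self_eq_norm_sq] at h3
  have h4 : ‖p‖ ^ 2 ≤ ‖g‖ * ‖p‖ :=
    (sub_nonneg.1 (nonneg_of_mul_nonneg_right h3 hl)).trans (real_inner_le_norm g p)
  rcases (norm_nonneg p).eq_or_lt with h | h
  · rw [← h]; exact norm_nonneg g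
  · exact le_of_mul_le_mul_right (by rwa [← sq]) h

/-- The domain of the part of `A` in `H` is dense. -/
theorem exists_isStrong_near [CompleteSpace V] [CompleteSpace H] {ι : V →L[ℝ] H}
    (hι : DenseRange ι) {a : V →L[ℝ] V →L[ℝ] ℝ} {α : ℝ} (hα : 0 < α)
    (ha : ∀ v, α * ‖v‖ ^ 2 ≤ a v v) (x : H) {ε : ℝ} (hε : 0 < ε) :
    ∃ v g, IsStrong ι a v g ∧ ‖ι v - x‖ < ε := by
  obtain ⟨v, hv⟩ := hι.exists_dist_lt x (half_pos hε)
  -- `C` is the maximum of `‖a v‖ * x - α * x ^ 2` over real `x`; `l` is chosen so that `l * (C + 1)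
  -- = (ε / 2) ^ 2`, the `+ 1` giving strictness.
  set C : ℝ := (‖a v‖) ^ 2 / (4 * α) with hC
  have hC0 : 0 ≤ C := by positivity
  set l : ℝ := (ε / 2) ^ 2 / (C + 1) with hl'
  have hl : 0 < l := by positivity
  obtain ⟨R, hR⟩ := exists_resolvent ι hα ha hl
  refine ⟨R (ι v), _, isStrong_resolvent hl hR (ι v), ?_⟩
  set r := R (ι v)
  have h1 : ‖ι (v - r)‖ ^ 2 = l * a r (v - r) := by
    have := hR (ι v) (v - r)
    rw [← real_inner_self_eq_norm_sq]
    nth_rewrite 1 [map_sub]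
    rw [inner_sub_left]
    linarith
  have h2 : a r (v - r) ≤ C := by
    have e : a r (v - r) = a v (v - r) - a (v - r) (v - r) := by simp
    have h3 : a v (v - r) ≤ ‖a v‖ * ‖v - r‖ := (le_abs_self _).trans ((a v).le_opNorm _)
    have h4 := ha (v - r)
    have h5 : ‖a v‖ * ‖v - r‖ - α * ‖v - r‖ ^ 2 ≤ C := by
      rw [hC, le_div_iff₀ (by positivity)]
      nlinarith [sq_nonneg (‖a v‖ - 2 * α * ‖v - r‖)]
    linarith
  have h3 : ‖ι (v - r)‖ ^ 2 < (ε / 2) ^ 2 := by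
    rw [h1]
    calc l * a r (v - r) ≤ l * C := by gcongr
      _ < l * (C + 1) := by gcongr; linarith
      _ = (ε / 2) ^ 2 := by rw [hl']; field_simp
  have h4 : ‖ι (v - r)‖ < ε / 2 := lt_of_pow_lt_pow_left₀ 2 (by positivity) h3
  have h5 : ι r - x = -(ι (v - r)) - (x - ι v) := by rw [map_sub]; abel
  rw [h5]
  rw [dist_eq_norm] at hv
  calc _ ≤ ‖-(ι (v - r))‖ + ‖x - ι v‖ := norm_sub_le _ _
    _ < ε := by rw [norm_neg]; linarith

end Stationary

/-! ### Yosida approximation of the homogeneous evolution. -/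

section Yosida

variable {V H : Type*}
  [NormedAddCommGroup V] [InnerProductSpace ℝ V]
  [NormedAddCommGroup H] [InnerProductSpace ℝ H]

theorem hasDerivAt_exp_smul_apply [CompleteSpace H] (K : H →L[ℝ] H) (x : H) (t : ℝ) :
    HasDerivAt (fun t : ℝ => NormedSpace.exp (t • K) x) (K (NormedSpace.exp (t • K) x)) t :=
  (ContinuousLinearMap.apply ℝ H x).hasFDerivAt.comp_hasDerivAt t (hasDerivAt_exp_smul_const' K t)

theorem norm_exp_smul_apply_le [CompleteSpace H] {K : H →L[ℝ] H} (hK : ∀ h, ⟪K h, h⟫_ℝ ≤ 0)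
    (x : H) {t : ℝ} (ht : 0 ≤ t) : ‖NormedSpace.exp (t • K) x‖ ≤ ‖x‖ := by
  have hd : ∀ t, HasDerivAt (fun t : ℝ => ‖NormedSpace.exp (t • K) x‖ ^ 2)
      (2 * ⟪NormedSpace.exp (t • K) x, K (NormedSpace.exp (t • K) x)⟫_ℝ) t :=
    fun t => (hasDerivAt_exp_smul_apply K x t).norm_sq
  have hm : Antitone (fun t : ℝ => ‖NormedSpace.exp (t • K) x‖ ^ 2) :=
    antitone_of_hasDerivAt_nonpos hd fun t => by
      have := hK (NormedSpace.exp (t • K) x)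
      rw [real_inner_comm] at this
      simp only [Pi.zero_apply]
      linarith
  have := hm ht
  simp only [zero_smul, NormedSpace.exp_zero, one_apply_eq_self] at this
  exact le_of_sq_le_sq this (norm_nonneg _)

/-- Yosida approximation of the evolution equation with initial value in the domain. -/
theorem exists_yosida_approx [CompleteSpace V] [CompleteSpace H] (ι : V →L[ℝ] H)
    {a : V →L[ℝ] V →L[ℝ] ℝ} {α : ℝ} (hα : 0 < α)
    (ha : ∀ v, α * ‖v‖ ^ 2 ≤ a v v) {v : V} {g : H} (hv : IsStrong ι a v g)
    {l : ℝ} (hl : 0 < l) :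
    ∃ (r : ℝ → V) (y p : ℝ → H), Continuous r ∧ (∀ t, y t = ι (r t) + l • p t) ∧
      (∀ t, IsStrong ι a (r t) (p t)) ∧ (∀ t, HasDerivAt y (-(p t)) t) ∧ y 0 = ι v ∧
      ∀ t, 0 ≤ t → ‖p t‖ ≤ ‖g‖ := by
  obtain ⟨R, hR⟩ := exists_resolvent ι hα ha hl
  have ha0 : ∀ v, 0 ≤ a v v := fun v => le_trans (by positivity) (ha v)
  -- `-K` is the Yosida approximation of A: bounded on `H` and monotone, so its evolution is an
  -- exponential and contracts.
  let K : H →L[ℝ] H := l⁻¹ • (ι.comp R - ContinuousLinearMap.id ℝ H)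
  have hK : ∀ h, K h = -(l⁻¹ • (h - ι (R h))) := fun h => by
    rw [← smul_neg, neg_sub]; rfl
  have hKd : ∀ h, ⟪K h, h⟫_ℝ ≤ 0 := fun h => by
    have h1 := isStrong_resolvent hl hR h (R h)
    have h2 := ha0 (R h)
    have h3 : h = ι (R h) + l • (l⁻¹ • (h - ι (R h))) := by
      rw [smul_inv_smul₀ hl.ne']; abel
    rw [hK, inner_neg_left]
    nth_rewrite 3 [h3]
    rw [inner_add_right, ← h1, real_inner_smul_right, real_inner_self_eq_norm_sq]
    have : 0 ≤ l * ‖l⁻¹ • (h - ι (R h))‖ ^ 2 := by positivity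
    linarith
  let y : ℝ → H := fun t => NormedSpace.exp (t • K) (ι v)
  have hy : ∀ t, HasDerivAt y (K (y t)) t := hasDerivAt_exp_smul_apply K (ι v)
  have hyc : Continuous y := continuous_iff_continuousAt.2 fun t => (hy t).continuousAt
  refine ⟨fun t => R (y t), y, fun t => -K (y t), R.continuous.comp hyc, fun t => ?_,
    fun t => ?_, fun t => ?_, ?_, fun t ht => ?_⟩
  · beta_reduce
    rw [hK, neg_neg, smul_inv_smul₀ hl.ne']; abel
  · beta_reduce
    rw [hK, neg_neg]
    exact isStrong_resolvent hl hR (y t)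
  · rw [neg_neg]; exact hy t
  · simp [y]
  -- Since `K` commutes with its exponential, `p t` evolves by the same contraction and is bounded
  -- by its initial norm.
  · have hc : K (y t) = NormedSpace.exp (t • K) (K (ι v)) := by
      have h1 : Commute K (NormedSpace.exp (t • K)) :=
        ((Commute.refl K).smul_right t).exp_right
      exact DFunLike.congr_fun h1.eq (ι v)
    rw [norm_neg, hc]
    refine (norm_exp_smul_apply_le hKd _ ht).trans ?_
    rw [hK, norm_neg]
    exact norm_yosida_le ha0 hl hR hv

end Yosida

/-! ### Convergence of the Yosida approximations. -/

section Komura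

variable {V H : Type*}
  [NormedAddCommGroup V] [InnerProductSpace ℝ V]
  [NormedAddCommGroup H] [InnerProductSpace ℝ H]

/-- In the derivative of `‖y - y'‖ ^ 2`, split `y - y'` into `ι (r - r')` and `l • p - m • p'`. The
first part contributes `-2 a(r - r', r - r') ≤ 0`, the second at most `4 * (l + m) * G ^ 2`. -/
theorem norm_sub_sq_le_of_approx {ι : V →L[ℝ] H} {a : V →L[ℝ] V →L[ℝ] ℝ} (ha : ∀ v, 0 ≤ a v v)
    {l m G : ℝ} (hl : 0 ≤ l) (hm : 0 ≤ m)
    {r r' : ℝ → V} {y y' p p' : ℝ → H}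
    (hy : ∀ t, y t = ι (r t) + l • p t) (hy' : ∀ t, y' t = ι (r' t) + m • p' t)
    (hr : ∀ t, IsStrong ι a (r t) (p t)) (hr' : ∀ t, IsStrong ι a (r' t) (p' t))
    (hd : ∀ t, HasDerivAt y (-(p t)) t) (hd' : ∀ t, HasDerivAt y' (-(p' t)) t)
    (h0 : y 0 = y' 0) (hp : ∀ t, 0 ≤ t → ‖p t‖ ≤ G) (hp' : ∀ t, 0 ≤ t → ‖p' t‖ ≤ G)
    {t : ℝ} (ht : 0 ≤ t) : ‖y t - y' t‖ ^ 2 ≤ 4 * (l + m) * G ^ 2 * t := by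
  have hG : 0 ≤ G := (norm_nonneg _).trans (hp 0 le_rfl)
  have hdd : ∀ t, HasDerivAt (fun t => ‖y t - y' t‖ ^ 2 - 4 * (l + m) * G ^ 2 * t)
      (2 * ⟪y t - y' t, -(p t) - -(p' t)⟫_ℝ - 4 * (l + m) * G ^ 2 * 1) t := fun t =>
    (((hd t).sub (hd' t)).norm_sq).sub ((hasDerivAt_id t).const_mul _)
  have hanti : AntitoneOn (fun t => ‖y t - y' t‖ ^ 2 - 4 * (l + m) * G ^ 2 * t) (Ici 0) := by
    refine antitoneOn_of_deriv_nonpos (convex_Ici 0)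
      (fun t _ => (hdd t).continuousAt.continuousWithinAt)
      (fun t _ => (hdd t).differentiableAt.differentiableWithinAt) fun t ht => ?_
    rw [interior_Ici] at ht
    rw [(hdd t).deriv]
    have ht' : 0 ≤ t := le_of_lt ht
    have e1 : ⟪y t - y' t, -(p t) - -(p' t)⟫_ℝ
        = -(a (r t - r' t) (r t - r' t)) + ⟪l • p t - m • p' t, p' t - p t⟫_ℝ := by
      have : a (r t - r' t) (r t - r' t) = ⟪p t - p' t, ι (r t - r' t)⟫_ℝ := by
        rw [map_sub a, sub_apply, hr, hr', inner_sub_left]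
      rw [this, real_inner_comm (ι _), ← inner_neg_right, hy, hy', map_sub, neg_sub,
        ← inner_add_left, neg_sub_neg]
      congr 1
      abel
    have e2 : ⟪l • p t - m • p' t, p' t - p t⟫_ℝ ≤ (l * G + m * G) * (G + G) := by
      refine (real_inner_le_norm _ _).trans ?_
      gcongr
      · refine (norm_sub_le _ _).trans ?_
        rw [norm_smul, norm_smul, Real.norm_of_nonneg hl, Real.norm_of_nonneg hm]
        gcongr
        exacts [hp t ht', hp' t ht']
      · exact (norm_sub_le _ _).trans (add_le_add (hp' t ht') (hp t ht'))
    rw [e1]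
    have := ha (r t - r' t)
    nlinarith
  have := hanti (self_mem_Ici (a := (0:ℝ))) ht ht
  simp only [h0, sub_self, norm_zero, mul_zero] at this
  linarith

/-- Coercivity upgrades closeness in `H` to closeness in `V`, because `a (r - r')` is represented by
the bounded vector `p - p'` of `H`. -/
theorem mul_norm_sub_sq_le_of_approx {ι : V →L[ℝ] H} {a : V →L[ℝ] V →L[ℝ] ℝ} {α : ℝ}
    (ha : ∀ v, α * ‖v‖ ^ 2 ≤ a v v)
    {l m G : ℝ} (hl : 0 ≤ l) (hm : 0 ≤ m) {r r' : V} {y y' p p' : H}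
    (hy : y = ι r + l • p) (hy' : y' = ι r' + m • p')
    (hr : IsStrong ι a r p) (hr' : IsStrong ι a r' p') (hp : ‖p‖ ≤ G) (hp' : ‖p'‖ ≤ G) :
    α * ‖r - r'‖ ^ 2 ≤ 2 * G * (‖y - y'‖ + (l + m) * G) := by
  have hG : 0 ≤ G := (norm_nonneg _).trans hp
  have e : ι (r - r') = (y - y') - (l • p - m • p') := by rw [hy, hy', map_sub]; abel
  calc α * ‖r - r'‖ ^ 2 ≤ a (r - r') (r - r') := ha _
    _ = ⟪p - p', ι (r - r')⟫_ℝ := by rw [map_sub a, sub_apply, hr, hr', inner_sub_left]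
    _ ≤ ‖p - p'‖ * ‖ι (r - r')‖ := real_inner_le_norm _ _
    _ ≤ (G + G) * (‖y - y'‖ + (l * G + m * G)) := by
        gcongr
        · exact (norm_sub_le _ _).trans (add_le_add hp hp')
        · rw [e]
          refine (norm_sub_le _ _).trans ?_
          gcongr
          refine (norm_sub_le _ _).trans ?_
          rw [norm_smul, norm_smul, Real.norm_of_nonneg hl, Real.norm_of_nonneg hm]
          gcongr
    _ = _ := by ring

/-- A classical solution of `y' + A y = 0` on `(0,s)`. -/
structure IsClassical (ι : V →L[ℝ] H) (a : V →L[ℝ] V →L[ℝ] ℝ) (s : ℝ) (v : ℝ → V) : Prop where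
  continuousOn : ContinuousOn v (Icc 0 s)
  hasDerivAt : ∀ t ∈ Ioo 0 s, HasDerivAt (fun t => toDual ι (ι (v t))) (-(a (v t))) t

/-- The approximants converge pointwise in H and their derivatives `-(a (r n t))` uniformly in V*,
so the limit may be differentiated termwise. -/
theorem exists_isClassical [CompleteSpace V] [CompleteSpace H] (ι : V →L[ℝ] H)
    {a : V →L[ℝ] V →L[ℝ] ℝ} {α : ℝ} (hα : 0 < α)
    (ha : ∀ v, α * ‖v‖ ^ 2 ≤ a v v) {ξ : V} {g : H} (hξ : IsStrong ι a ξ g)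
    {s : ℝ} (hs : 0 ≤ s) : ∃ v, IsClassical ι a s v ∧ ι (v 0) = ι ξ := by
  have ha0 : ∀ v, 0 ≤ a v v := fun v => le_trans (by positivity) (ha v)
  let l : ℕ → ℝ := fun n => 1 / ((n : ℝ) + 1)
  have hl : ∀ n, 0 < l n := fun n => Nat.one_div_pos_of_nat
  have hl0 : Tendsto l atTop (𝓝 0) := tendsto_one_div_add_atTop_nhds_zero_nat
  have hlm : ∀ m n, m ≤ n → l n ≤ l m := fun m n h => Nat.one_div_le_one_div h
  choose r y p hrc hy hr hd h0 hp using fun n => exists_yosida_approx ι hα ha hξ (hl n)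
  set G := ‖g‖
  -- Combination of the two Kōmura estimates for indices beyond `N`, where `l n + l m ≤ 2 * l N`.
  let η : ℝ → ℝ := fun e => 2 * G * (√(8 * e * G ^ 2 * s) + 2 * e * G)
  have hη : Tendsto (fun n => η (l n)) atTop (𝓝 0) := by
    have : Continuous η := by fun_prop
    have h := (this.tendsto 0).comp hl0
    simpa [η, Function.comp_def] using h
  have key : ∀ N n m, N ≤ n → N ≤ m → ∀ t ∈ Icc 0 s, α * ‖r n t - r m t‖ ^ 2 ≤ η (l N) := by
    intro N n m hn hm t ht
    refine (mul_norm_sub_sq_le_of_approx ha (hl n).le (hl m).le (hy n t) (hy m t) (hr n t)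
      (hr m t) (hp n t ht.1) (hp m t ht.1)).trans ?_
    have h1 := norm_sub_sq_le_of_approx ha0 (hl n).le (hl m).le (hy n) (hy m) (hr n) (hr m)
      (hd n) (hd m) ((h0 n).trans (h0 m).symm) (hp n) (hp m) ht.1
    have h2 := hlm N n hn
    have h3 := hlm N m hm
    have h4 : ‖y n t - y m t‖ ≤ √(8 * l N * G ^ 2 * s) := by
      refine Real.le_sqrt_of_sq_le (h1.trans ?_)
      have : l n + l m ≤ 2 * l N := by linarith
      calc 4 * (l n + l m) * G ^ 2 * t ≤ 4 * (2 * l N) * G ^ 2 * s := by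
            have := ht.2
            have := ht.1
            have := (hl N).le
            gcongr
        _ = _ := by ring
    have : l n + l m ≤ 2 * l N := by linarith
    show _ ≤ 2 * G * (√(8 * l N * G ^ 2 * s) + 2 * l N * G)
    gcongr
  have hcau : UniformCauchySeqOn r atTop (Icc 0 s) := by
    rw [Metric.uniformCauchySeqOn_iff]
    intro ε hε
    obtain ⟨N, hN⟩ := (hη.eventually (gt_mem_nhds (show 0 < α * ε ^ 2 by positivity))).exists
    refine ⟨N, fun n hn m hm t ht => ?_⟩
    rw [dist_eq_norm]
    have h := (key N n m hn hm t ht).trans_lt hN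
    exact lt_of_pow_lt_pow_left₀ 2 hε.le (lt_of_mul_lt_mul_left h hα.le)
  have hlim : ∀ t, ∃ v, t ∈ Icc 0 s → Tendsto (fun n => r n t) atTop (𝓝 v) := fun t => by
    by_cases ht : t ∈ Icc 0 s
    · obtain ⟨v, hv⟩ := cauchySeq_tendsto_of_complete (hcau.cauchySeq ht)
      exact ⟨v, fun _ => hv⟩
    · exact ⟨0, fun h => absurd h ht⟩
  choose v hv using hlim
  have hunif : TendstoUniformlyOn r v atTop (Icc 0 s) :=
    hcau.tendstoUniformlyOn_of_tendsto fun t ht => hv t ht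
  have hylim : ∀ t ∈ Icc 0 s, Tendsto (fun n => y n t) atTop (𝓝 (ι (v t))) := fun t ht => by
    have h1 : Tendsto (fun n => l n • p n t) atTop (𝓝 0) := by
      refine squeeze_zero_norm (a := fun n => l n * G) (fun n => ?_) (by simpa using hl0.mul_const G)
      rw [norm_smul, Real.norm_of_nonneg (hl n).le]
      exact mul_le_mul_of_nonneg_left (hp n t ht.1) (hl n).le
    have h2 := ((ι.continuous.tendsto _).comp (hv t ht)).add h1
    rw [add_zero] at h2
    exact h2.congr fun n => (hy n t).symm
  refine ⟨v, ⟨hunif.continuousOn (Eventually.of_forall fun n => (hrc n).continuousOn).frequently,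
    fun t ht => ?_⟩, ?_⟩
  · refine hasDerivAt_of_tendstoUniformlyOn (l := atTop) (f := fun n t => toDual ι (y n t))
      (f' := fun n t => -(a (r n t))) (g := fun t => toDual ι (ι (v t)))
      (g' := fun t => -(a (v t))) (s := Ioo 0 s) isOpen_Ioo ?_
      (Eventually.of_forall fun n t ht => ?_) (fun t ht => ?_) ht
    · exact (-a).uniformContinuous.comp_tendstoUniformlyOn (hunif.mono Ioo_subset_Icc_self)
    · have h := (toDualL ι).hasFDerivAt.comp_hasDerivAt t (hd n t)
      have e : (toDualL ι) (-(p n t)) = -(a (r n t)) := by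
        ext w
        rw [neg_apply, hr n t w, ← inner_neg_left]
        rfl
      rw [e] at h
      exact h
    · exact ((toDualL ι).continuous.tendsto _).comp (hylim t (Ioo_subset_Icc_self ht))
  · have h1 := hylim 0 ⟨le_rfl, hs⟩
    simp only [h0] at h1
    exact tendsto_nhds_unique tendsto_const_nhds h1 |>.symm

end Komura

/-! ### Energy inequality and linear decay of the distance. -/

section Energy

variable {V H : Type*}
  [NormedAddCommGroup V] [InnerProductSpace ℝ V]
  [NormedAddCommGroup H] [InnerProductSpace ℝ H]

theorem IsClassical.sub {ι : V →L[ℝ] H} {a : V →L[ℝ] V →L[ℝ] ℝ} {s : ℝ} {v w : ℝ → V}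
    (hv : IsClassical ι a s v) (hw : IsClassical ι a s w) :
    IsClassical ι a s (fun t => v t - w t) := by
  refine ⟨hv.1.sub hw.1, fun t ht => ?_⟩
  have h := (hv.2 t ht).sub (hw.2 t ht)
  simp only [map_sub, toDual_sub, neg_sub']
  exact h

/-- The energy identity `d/dt ‖z‖² = 2 ⟨z', z⟩`. -/
theorem hasDerivAt_norm_sq {ι : V →L[ℝ] H} {z : ℝ → V} {g : StrongDual ℝ V} {t : ℝ}
    (hc : ContinuousAt z t) (hd : HasDerivAt (fun t => toDual ι (ι (z t))) g t) :
    HasDerivAt (fun t => ‖ι (z t)‖ ^ 2) (2 * g (z t)) t := by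
  rw [hasDerivAt_iff_tendsto_slope] at hd ⊢
  -- The slope of `‖ι z‖ ^ 2` is the V*-valued slope applied to `z r + z t`, so continuity of `z` in
  -- `V` suffices and no derivative in `V` is needed.
  have h1 : Tendsto (fun r => z r + z t) (𝓝[≠] t) (𝓝 (z t + z t)) :=
    (hc.tendsto.mono_left nhdsWithin_le_nhds).add tendsto_const_nhds
  have h2 : Tendsto (fun r => slope (fun t => toDual ι (ι (z t))) t r (z r + z t)) (𝓝[≠] t)
      (𝓝 (g (z t + z t))) :=
    (isBoundedBilinearMap_apply (𝕜 := ℝ) (E := V) (F := ℝ)).continuous.tendsto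
      (g, z t + z t) |>.comp (hd.prodMk_nhds h1)
  have h3 : g (z t + z t) = 2 * g (z t) := by rw [map_add]; ring
  rw [h3] at h2
  refine h2.congr fun r => ?_
  rw [slope_def_module, slope_def_field, smul_apply, sub_apply, toDual_apply, toDual_apply,
    ← inner_sub_left, map_add, smul_eq_mul]
  have : ⟪ι (z r) - ι (z t), ι (z r) + ι (z t)⟫_ℝ = ‖ι (z r)‖ ^ 2 - ‖ι (z t)‖ ^ 2 := by
    rw [inner_sub_left, inner_add_right, inner_add_right, real_inner_self_eq_norm_sq,
      real_inner_self_eq_norm_sq, real_inner_comm (ι (z r))]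
    ring
  rw [this]
  ring

/-- Applied to differences of solutions, this controls the `C([0,s]; H)` and `L²((0,s); V)`
distances at once. -/
theorem IsClassical.energy_le {ι : V →L[ℝ] H} {a : V →L[ℝ] V →L[ℝ] ℝ} {α : ℝ}
    (ha : ∀ v, α * ‖v‖ ^ 2 ≤ a v v) {s : ℝ} {v : ℝ → V} (hv : IsClassical ι a s v)
    {t : ℝ} (ht : t ∈ Icc 0 s) :
    ‖ι (v t)‖ ^ 2 + 2 * α * ∫ r in 0..t, ‖v r‖ ^ 2 ≤ ‖ι (v 0)‖ ^ 2 := by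
  have hsub : Icc 0 t ⊆ Icc 0 s := Icc_subset_Icc_right ht.2
  have hvc := hv.1.mono hsub
  have h1 : ContinuousOn (fun r => ‖v r‖ ^ 2) (uIcc 0 t) := by
    rw [uIcc_of_le ht.1]; exact hvc.norm.pow 2
  have h2 : ContinuousOn (fun r => 2 * (-(a (v r))) (v r)) (uIcc 0 t) := by
    rw [uIcc_of_le ht.1]
    exact continuousOn_const.mul (((a.continuous.comp_continuousOn hvc).neg).clm_apply hvc)
  have h3 := intervalIntegral.integral_eq_sub_of_hasDerivAt_of_le ht.1
    (f := fun r => ‖ι (v r)‖ ^ 2) ((ι.continuous.comp_continuousOn hvc).norm.pow 2)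
    (fun r hr => hasDerivAt_norm_sq
      (hv.1.continuousAt (Icc_mem_nhds hr.1 (hr.2.trans_le ht.2)))
      (hv.2 r ⟨hr.1, hr.2.trans_le ht.2⟩)) h2.intervalIntegrable
  have h4 : ∫ r in 0..t, 2 * (-(a (v r))) (v r) ≤ ∫ r in 0..t, (-(2 * α)) * ‖v r‖ ^ 2 := by
    refine intervalIntegral.integral_mono_on ht.1 h2.intervalIntegrable
      (h1.intervalIntegrable.const_mul _) fun r _ => ?_
    have := ha (v r)
    rw [neg_apply]
    linarith
  rw [h3, intervalIntegral.integral_const_mul] at h4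
  linarith

/-- The distance in `H` to a point decreases at a linear rate outside a ball, provided the
defect of that point in the stationary equation is small. -/
theorem IsClassical.norm_add_sub_le {ι : V →L[ℝ] H} (hι : ∀ v, ‖ι v‖ ≤ ‖v‖)
    {a : V →L[ℝ] V →L[ℝ] ℝ} {α : ℝ} (hα : 0 < α)
    (ha : ∀ v, α * ‖v‖ ^ 2 ≤ a v v) {s : ℝ} {v : ℝ → V} (hv : IsClassical ι a s v)
    {q : V} {d κ M : ℝ} (hd : 0 < d) (hκ : ‖a q‖ + κ < α * d)
    (h0 : ‖ι (v 0 + q)‖ ≤ M) (hM : d ≤ M - κ * s) (hκ0 : 0 ≤ κ) {t : ℝ} (ht : t ∈ Icc 0 s) :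
    ‖ι (v t + q)‖ ≤ M - κ * t := by
  have hs : 0 ≤ s := ht.1.trans ht.2
  have hBd : ∀ r ∈ Icc 0 s, d ≤ M - κ * r := fun r hr => by
    have := mul_le_mul_of_nonneg_left hr.2 hκ0
    linarith
  set f : ℝ → ℝ := fun r => ‖ι (v r + q)‖ ^ 2
  set f' : ℝ → ℝ := fun r => 2 * (-(a (v r))) (v r + q)
  have hvq : ContinuousOn (fun r => v r + q) (Icc 0 s) := hv.1.add continuousOn_const
  have hfc : ContinuousOn f (Icc 0 s) := (ι.continuous.comp_continuousOn hvq).norm.pow 2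
  have hf'c : ContinuousOn f' (Icc 0 s) :=
    continuousOn_const.mul (((a.continuous.comp_continuousOn hv.1).neg).clm_apply hvq)
  have hfd : ∀ r ∈ Ioo 0 s, HasDerivAt f (f' r) r := fun r hr => by
    refine hasDerivAt_norm_sq (hvq.continuousAt (Icc_mem_nhds hr.1 hr.2)) ?_
    have := (hv.2 r hr).add_const (toDual ι (ι q))
    simpa only [map_add, toDual_add] using this
  -- The comparison principle needs a right derivative at `0` too; it comes from continuity of `f'`
  -- up to the endpoint.
  have hfr : ∀ r ∈ Ico 0 s, HasDerivWithinAt f (f' r) (Ici r) r := fun r hr => by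
    have hm : Ioo r s ∈ 𝓝[>] r := Ioo_mem_nhdsGT hr.2
    have hsub : Ioo r s ⊆ Icc 0 s := fun x hx => ⟨hr.1.trans hx.1.le, hx.2.le⟩
    have hsub' : Ioo r s ⊆ Ioo 0 s := fun x hx => ⟨hr.1.trans_lt hx.1, hx.2⟩
    refine hasDerivWithinAt_Ici_of_tendsto_deriv (s := Ioo r s)
      (fun x hx => (hfd x (hsub' hx)).differentiableAt.differentiableWithinAt)
      ((hfc r (Ico_subset_Icc_self hr)).mono hsub) hm ?_
    have h1 : Tendsto f' (𝓝[>] r) (𝓝 (f' r)) := by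
      rw [← nhdsWithin_Ioo_eq_nhdsGT hr.2]
      exact ((hf'c r (Ico_subset_Icc_self hr)).mono hsub).tendsto
    refine h1.congr' ?_
    filter_upwards [hm] with x hx
    exact (hfd x (hsub' hx)).deriv.symm
  have hB : ∀ r, HasDerivAt (fun r => (M - κ * r) ^ 2) (2 * (M - κ * r) * (-κ)) r := fun r => by
    have := (((hasDerivAt_id r).const_mul κ).const_sub M).pow 2
    refine this.congr_deriv ?_
    simp
  -- The barrier `(M - κ * r) ^ 2` need only be beaten where `f` touches it; there `‖ι z‖ = M - κ *
  -- r ≥ d`, hence `‖z‖ ≥ d`.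
  have hle := image_le_of_deriv_right_lt_deriv_boundary hfc hfr
    (B := fun r => (M - κ * r) ^ 2) (by
      show ‖ι (v 0 + q)‖ ^ 2 ≤ (M - κ * 0) ^ 2
      rw [mul_zero, sub_zero]
      gcongr) hB (fun r hr he => ?_) ht
  · exact (sq_le_sq₀ (norm_nonneg _) (hd.le.trans (hBd t ht))).1 hle
  · have hr' := Ico_subset_Icc_self hr
    have hb := hBd r hr'
    have he' : ‖ι (v r + q)‖ = M - κ * r :=
      (sq_eq_sq₀ (norm_nonneg _) (hd.le.trans hb)).1 he
    set z := v r + q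
    have e1 : f' r = 2 * (a q z - a z z) := by
      simp only [f', z, map_add, add_apply, neg_apply]
      ring
    have h1 : a q z ≤ ‖a q‖ * ‖z‖ := (le_abs_self _).trans ((a q).le_opNorm z)
    have h2 := ha z
    have h3 := hι z
    rw [e1, ← he']
    have h4 : d ≤ ‖z‖ := by linarith
    have h5 : α * d * ‖z‖ ≤ α * ‖z‖ ^ 2 := by
      rw [sq, mul_assoc]; gcongr
    have h6 : κ * ‖ι z‖ ≤ κ * ‖z‖ := by gcongr
    have h7 : 0 < ‖z‖ := hd.trans_le h4
    nlinarith [mul_pos (sub_pos.2 hκ) h7]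

end Energy

/-! ### Homogeneous equation with initial values in `H`. -/

section Weak

variable {V H : Type*}
  [NormedAddCommGroup V] [InnerProductSpace ℝ V]
  [NormedAddCommGroup H] [InnerProductSpace ℝ H]

theorem intervalIntegral_eq_setIntegral_Ioo {X : Type*} [NormedAddCommGroup X] [NormedSpace ℝ X]
    {s t : ℝ} (ht : t ∈ Icc 0 s) (f : ℝ → X) :
    ∫ r in 0..t, f r = ∫ r in Ioo 0 t, f r ∂(volume.restrict (Ioo 0 s)) := by
  rw [intervalIntegral.integral_of_le ht.1, integral_Ioc_eq_integral_Ioo,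
    Measure.restrict_restrict measurableSet_Ioo,
    inter_eq_left.2 (Ioo_subset_Ioo_right ht.2)]

theorem memLp_two_of_continuousOn {X : Type*} [NormedAddCommGroup X] {s : ℝ} {v : ℝ → X}
    (hv : ContinuousOn v (Icc 0 s)) : MemLp v 2 (volume.restrict (Ioo 0 s)) := by
  obtain ⟨C, hC⟩ := isCompact_Icc.exists_bound_of_continuousOn hv
  refine MemLp.of_bound ((hv.mono Ioo_subset_Icc_self).aestronglyMeasurable measurableSet_Ioo) C ?_
  filter_upwards [ae_restrict_mem measurableSet_Ioo] with t ht using hC t (Ioo_subset_Icc_self ht)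

theorem norm_toLp_two_sq {X : Type*} [NormedAddCommGroup X] [InnerProductSpace ℝ X]
    {Ω : Type*} [MeasurableSpace Ω] {μ : Measure Ω} {f : Ω → X} (hf : MemLp f 2 μ) :
    ‖hf.toLp f‖ ^ 2 = ∫ x, ‖f x‖ ^ 2 ∂μ := by
  rw [← real_inner_self_eq_norm_sq, L2.inner_def]
  refine integral_congr_ae ?_
  filter_upwards [hf.coeFn_toLp] with x hx
  rw [hx, real_inner_self_eq_norm_sq]

/-- Convergence in `L²(0,s)` implies convergence of the integrals of images under bounded
operators. -/
theorem tendsto_intervalIntegral_of_tendsto_Lp {X Y : Type*} [NormedAddCommGroup X]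
    [NormedSpace ℝ X] [NormedAddCommGroup Y] [NormedSpace ℝ Y] (L : X →L[ℝ] Y) {s t : ℝ}
    (ht : t ∈ Icc 0 s)
    {F : ℕ → Lp X 2 (volume.restrict (Ioo 0 s))} {f : Lp X 2 (volume.restrict (Ioo 0 s))}
    (h : Tendsto F atTop (𝓝 f)) :
    Tendsto (fun n => ∫ r in 0..t, L (F n r)) atTop (𝓝 (∫ r in 0..t, L (f r))) := by
  simp_rw [intervalIntegral_eq_setIntegral_Ioo ht]
  refine tendsto_setIntegral_of_L1' _ (L.comp_memLp f).aestronglyMeasurable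
    (Eventually.of_forall fun n => (L.comp_memLp (F n)).integrable one_le_two) ?_ _
  have h2 := (Lp.tendsto_Lp_iff_tendsto_eLpNorm' F f).1 h
  set C := (volume.restrict (Ioo 0 s)) univ ^ (1 / (1 : ℝ≥0∞).toReal - 1 / (2 : ℝ≥0∞).toReal) with hC
  have hCt : C ≠ ⊤ := ENNReal.rpow_ne_top_of_nonneg (by norm_num) (measure_ne_top _ _)
  have h3 : Tendsto (fun n => ENNReal.ofReal ‖L‖ * (eLpNorm (⇑(F n) - ⇑f) 2
      (volume.restrict (Ioo 0 s)) * C)) atTop (𝓝 0) := by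
    have := ENNReal.Tendsto.const_mul (a := ENNReal.ofReal ‖L‖)
      (ENNReal.Tendsto.mul_const h2 (Or.inr hCt)) (Or.inr ENNReal.ofReal_ne_top)
    simpa using this
  refine tendsto_of_tendsto_of_tendsto_of_le_of_le tendsto_const_nhds h3 (fun _ => zero_le)
    fun n => ?_
  refine (eLpNorm_le_mul_eLpNorm_of_ae_le_mul (g := ⇑(F n) - ⇑f) (c := ‖L‖)
    (Eventually.of_forall fun r => ?_) 1).trans ?_
  · simp only [Pi.sub_apply, Function.comp_apply]
    rw [← map_sub]
    exact L.le_opNorm _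
  · gcongr
    exact eLpNorm_le_eLpNorm_mul_rpow_measure_univ one_le_two
      ((Lp.aestronglyMeasurable _).sub (Lp.aestronglyMeasurable _))

/-- A solution of `y' + A y = 0` on `(0,s)` in integrated form, with values in `H`
given by `Y`. -/
structure IsIntegrated (ι : V →L[ℝ] H) (a : V →L[ℝ] V →L[ℝ] ℝ) (s : ℝ) (v : ℝ → V)
    (Y : ℝ → H) : Prop where
  memLp : MemLp v 2 (volume.restrict (Ioo 0 s))
  contRep : IsContRep ι s v Y
  integral_eq : ∀ t ∈ Icc 0 s, toDual ι (Y t) = toDual ι (Y 0) - ∫ r in 0..t, a (v r)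

theorem IsClassical.isIntegrated {ι : V →L[ℝ] H} {a : V →L[ℝ] V →L[ℝ] ℝ} {s : ℝ} {v : ℝ → V}
    (hv : IsClassical ι a s v) : IsIntegrated ι a s v (fun t => ι (v t)) := by
  refine ⟨memLp_two_of_continuousOn hv.1,
    ⟨ι.continuous.comp_continuousOn hv.1, Eventually.of_forall fun _ => rfl⟩, fun t ht => ?_⟩
  have hvc := hv.1.mono (Icc_subset_Icc_right ht.2)
  have h := intervalIntegral.integral_eq_sub_of_hasDerivAt_of_le ht.1
    (f := fun r => toDual ι (ι (v r))) (f' := fun r => -(a (v r)))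
    (((toDualL ι).comp ι).continuous.comp_continuousOn hvc)
    (fun r hr => hv.2 r ⟨hr.1, hr.2.trans_le ht.2⟩)
    (ContinuousOn.intervalIntegrable (by
      rw [uIcc_of_le ht.1]; exact (a.continuous.comp_continuousOn hvc).neg))
  rw [intervalIntegral.integral_neg] at h
  rw [sub_eq_add_neg, h]
  abel

/-- Solvability of the homogeneous evolution equation for initial values in `H`, together with
the linear decrease of the distance to `-q`. -/
theorem exists_isIntegrated [CompleteSpace V] [CompleteSpace H] {ι : V →L[ℝ] H}
    (hιd : DenseRange ι) (hι : ∀ v, ‖ι v‖ ≤ ‖v‖)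
    {a : V →L[ℝ] V →L[ℝ] ℝ} {α : ℝ} (hα : 0 < α)
    (ha : ∀ v, α * ‖v‖ ^ 2 ≤ a v v) (x : H) {s : ℝ} (hs : 0 ≤ s)
    {q : V} {d κ M : ℝ} (hd : 0 < d) (hκ : ‖a q‖ + κ < α * d)
    (h0 : ‖x + ι q‖ ≤ M) (hM : d ≤ M - κ * s) (hκ0 : 0 ≤ κ) :
    ∃ v Y, IsIntegrated ι a s v Y ∧ Y 0 = x ∧ ‖Y s + ι q‖ ≤ M - κ * s := by
  choose ξ g hξ hξx using fun n : ℕ =>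
    exists_isStrong_near hιd hα ha x (Nat.one_div_pos_of_nat (α := ℝ) (n := n))
  choose v hv hv0 using fun n => exists_isClassical ι hα ha (hξ n) hs
  have hX : Tendsto (fun n => ι (ξ n)) atTop (𝓝 x) := by
    rw [tendsto_iff_norm_sub_tendsto_zero]
    exact squeeze_zero (fun _ => norm_nonneg _) (fun n => (hξx n).le)
      tendsto_one_div_add_atTop_nhds_zero_nat
  have hXc : CauchySeq (fun n => ι (ξ n)) := hX.cauchySeq
  have hnn : ∀ (n m : ℕ) (t : ℝ), 0 ≤ t → 0 ≤ ∫ r in 0..t, ‖v n r - v m r‖ ^ 2 :=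
    fun n m t ht => intervalIntegral.integral_nonneg ht fun r _ => by positivity
  have hen : ∀ n m, ∀ t ∈ Icc 0 s,
      ‖ι (v n t) - ι (v m t)‖ ^ 2 + 2 * α * ∫ r in 0..t, ‖v n r - v m r‖ ^ 2
        ≤ ‖ι (ξ n) - ι (ξ m)‖ ^ 2 := fun n m t ht => by
    have := ((hv n).sub (hv m)).energy_le ha ht
    simpa only [map_sub, hv0] using this
  -- convergence in `C([0,s]; H)`
  have hsup : ∀ n m, ∀ t ∈ Icc 0 s, ‖ι (v n t) - ι (v m t)‖ ≤ ‖ι (ξ n) - ι (ξ m)‖ :=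
    fun n m t ht => le_of_sq_le_sq (by
      have := hen n m t ht
      have := mul_nonneg (mul_nonneg zero_le_two hα.le) (hnn n m t ht.1)
      linarith) (norm_nonneg _)
  have hcau : UniformCauchySeqOn (fun n t => ι (v n t)) atTop (Icc 0 s) := by
    rw [Metric.uniformCauchySeqOn_iff]
    intro ε hε
    obtain ⟨N, hN⟩ := Metric.cauchySeq_iff.1 hXc ε hε
    refine ⟨N, fun n hn m hm t ht => lt_of_le_of_lt ?_ (hN n hn m hm)⟩
    rw [dist_eq_norm, dist_eq_norm]
    exact hsup n m t ht
  have hlim : ∀ t, ∃ h, t ∈ Icc 0 s → Tendsto (fun n => ι (v n t)) atTop (𝓝 h) := fun t => by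
    by_cases ht : t ∈ Icc 0 s
    · obtain ⟨v, hv⟩ := cauchySeq_tendsto_of_complete (hcau.cauchySeq ht)
      exact ⟨v, fun _ => hv⟩
    · exact ⟨0, fun h => absurd h ht⟩
  choose Y hY using hlim
  have hunif : TendstoUniformlyOn (fun n t => ι (v n t)) Y atTop (Icc 0 s) :=
    hcau.tendstoUniformlyOn_of_tendsto fun t ht => hY t ht
  have hYc : ContinuousOn Y (Icc 0 s) := hunif.continuousOn
    (Eventually.of_forall fun n => ι.continuous.comp_continuousOn (hv n).1).frequently
  have hY0 : Y 0 = x := by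
    have h1 := hY 0 ⟨le_rfl, hs⟩
    simp only [hv0] at h1
    exact tendsto_nhds_unique h1 hX
  -- convergence in `L²((0,s); V)`
  let μ : Measure ℝ := volume.restrict (Ioo 0 s)
  have hvL : ∀ n, MemLp (v n) 2 μ := fun n => memLp_two_of_continuousOn (hv n).1
  have hL2 : ∀ n m, 2 * α * ‖(hvL n).toLp - (hvL m).toLp‖ ^ 2 ≤ ‖ι (ξ n) - ι (ξ m)‖ ^ 2 := by
    intro n m
    rw [← MemLp.toLp_sub, norm_toLp_two_sq]
    have h1 := hen n m s ⟨hs, le_rfl⟩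
    rw [intervalIntegral.integral_of_le hs, integral_Ioc_eq_integral_Ioo] at h1
    have := sq_nonneg ‖ι (v n s) - ι (v m s)‖
    simp only [Pi.sub_apply]
    linarith
  have hLc : CauchySeq (fun n => (hvL n).toLp (v n)) := by
    rw [Metric.cauchySeq_iff]
    intro ε hε
    obtain ⟨N, hN⟩ := Metric.cauchySeq_iff.1 hXc (√(2 * α) * ε) (by positivity)
    refine ⟨N, fun n hn m hm => ?_⟩
    have h1 := hN n hn m hm
    rw [dist_eq_norm] at h1 ⊢
    have h2 : ‖ι (ξ n) - ι (ξ m)‖ ^ 2 < 2 * α * ε ^ 2 := by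
      have := pow_lt_pow_left₀ h1 (norm_nonneg _) two_ne_zero
      rwa [mul_pow, Real.sq_sqrt (by positivity)] at this
    exact lt_of_pow_lt_pow_left₀ 2 hε.le
      (lt_of_mul_lt_mul_left ((hL2 n m).trans_lt h2) (by positivity))
  obtain ⟨f, hf⟩ := cauchySeq_tendsto_of_complete hLc
  refine ⟨f, Y, ⟨Lp.memLp f, ⟨hYc, ?_⟩, fun t ht => ?_⟩, hY0, ?_⟩
  -- An a.e. convergent subsequence identifies the `L²` limit `f` with the uniform limit `Y`.
  · obtain ⟨ns, hns, hae⟩ := (tendstoInMeasure_of_tendsto_Lp hf).exists_seq_tendsto_ae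
    have hall : ∀ᵐ t ∂μ, ∀ n, (hvL n).toLp (v n) t = v n t := ae_all_iff.2 fun n => (hvL n).coeFn_toLp
    filter_upwards [hae, hall, ae_restrict_mem measurableSet_Ioo] with t h1 h2 ht
    simp only [h2] at h1
    exact tendsto_nhds_unique ((hY t (Ioo_subset_Icc_self ht)).comp hns.tendsto_atTop)
      ((ι.continuous.tendsto _).comp h1)
  · have h1 : Tendsto (fun n => toDual ι (ι (v n t))) atTop (𝓝 (toDual ι (Y t))) :=
      ((toDualL ι).continuous.tendsto _).comp (hY t ht)
    have h2 : Tendsto (fun n => toDual ι (ι (v n 0))) atTop (𝓝 (toDual ι (Y 0))) :=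
      ((toDualL ι).continuous.tendsto _).comp (hY 0 ⟨le_rfl, hs⟩)
    have h3 := tendsto_intervalIntegral_of_tendsto_Lp a ht hf
    have h4 : ∀ n, ∫ r in 0..t, a ((hvL n).toLp (v n) r) = ∫ r in 0..t, a (v n r) := fun n => by
      simp_rw [intervalIntegral_eq_setIntegral_Ioo ht]
      refine integral_congr_ae (ae_restrict_of_ae ?_)
      filter_upwards [(hvL n).coeFn_toLp] with r hr
      rw [hr]
    simp only [h4] at h3
    exact tendsto_nhds_unique h1
      ((h2.sub h3).congr fun n => ((hv n).isIntegrated.integral_eq t ht).symm)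
  · have hss : s ∈ Icc 0 s := ⟨hs, le_rfl⟩
    have h1 : Tendsto (fun n => ‖ι (v n s) + ι q‖) atTop (𝓝 ‖Y s + ι q‖) :=
      ((hY s hss).add_const _).norm
    -- The approximants may start slightly outside radius `M`; enlarging `M` by their initial error
    -- costs nothing in the limit.
    have h2 : Tendsto (fun n => M + ‖ι (ξ n) - x‖ - κ * s) atTop (𝓝 (M - κ * s)) := by
      have := ((tendsto_iff_norm_sub_tendsto_zero.1 hX).const_add M).sub_const (κ * s)
      simpa using this
    refine le_of_tendsto_of_tendsto' h1 h2 fun n => ?_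
    have hn := norm_nonneg (ι (ξ n) - x)
    rw [← map_add]
    refine (hv n).norm_add_sub_le hι hα ha hd hκ ?_ (by linarith) hκ0 hss
    rw [map_add, hv0]
    calc ‖ι (ξ n) + ι q‖ = ‖(x + ι q) + (ι (ξ n) - x)‖ := by congr 1; abel
      _ ≤ M + ‖ι (ξ n) - x‖ := (norm_add_le _ _).trans (by gcongr)

end Weak

/-! ### Weak derivatives and primitives. -/

section WeakDerivative

theorem eq_zero_of_tsupport_subset_Ioo {T t : ℝ} {φ : ℝ → ℝ} (hφ : tsupport φ ⊆ Ioo 0 T)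
    (ht : t ∉ Ioo 0 T) : φ t = 0 :=
  image_eq_zero_of_notMem_tsupport fun h => ht (hφ h)

/-- Integration by parts for a primitive of an integrable function. -/
theorem integral_deriv_mul_primitive {T c : ℝ} (hT : 0 ≤ T) {φ g : ℝ → ℝ} (hφ : ContDiff ℝ ∞ φ)
    (hs : tsupport φ ⊆ Ioo 0 T) (hg : IntervalIntegrable g volume 0 T) :
    ∫ t in Ioo 0 T, deriv φ t * (c + ∫ r in 0..t, g r) = -∫ t in Ioo 0 T, φ t * g t := by
  have hacφ : AbsolutelyContinuousOnInterval φ 0 T :=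
    (hφ.of_le (by exact_mod_cast le_top)).contDiffOn.absolutelyContinuousOnInterval
  have hacP : AbsolutelyContinuousOnInterval (fun t => ∫ r in 0..t, g r) 0 T :=
    hg.absolutelyContinuousOnInterval_intervalIntegral left_mem_uIcc
  have hacc : AbsolutelyContinuousOnInterval (fun _ : ℝ => c) 0 T :=
    (contDiff_const (n := 1)).contDiffOn.absolutelyContinuousOnInterval
  have hP : AbsolutelyContinuousOnInterval (fun t => c + ∫ r in 0..t, g r) 0 T := hacc.add hacP
  have h := hP.integral_mul_deriv_eq_deriv_mul hacφ
  have e0 : φ 0 = 0 := eq_zero_of_tsupport_subset_Ioo hs (by simp)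
  have eT : φ T = 0 := eq_zero_of_tsupport_subset_Ioo hs (by simp)
  rw [e0, eT, mul_zero, mul_zero, sub_zero, zero_sub] at h
  have h2 : ∫ t in 0..T, deriv (fun t => c + ∫ r in 0..t, g r) t * φ t
      = ∫ t in 0..T, φ t * g t := by
    refine intervalIntegral.integral_congr_ae ?_
    filter_upwards [hg.ae_hasDerivAt_integral] with t ht hmem
    rw [(((ht (uIoc_subset_uIcc hmem)) 0 left_mem_uIcc).const_add c).deriv, mul_comm]
  rw [h2] at h
  rw [← integral_Ioc_eq_integral_Ioo, ← integral_Ioc_eq_integral_Ioo,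
    ← intervalIntegral.integral_of_le hT, ← intervalIntegral.integral_of_le hT, ← h]
  simp_rw [mul_comm]

variable {X : Type*} [NormedAddCommGroup X] [NormedSpace ℝ X]

theorem intervalIntegrable_of_memLp {X : Type*} [NormedAddCommGroup X] {T : ℝ} (hT : 0 ≤ T)
    {g : ℝ → X}
    (hg : MemLp g 2 (volume.restrict (Ioo 0 T))) : IntervalIntegrable g volume 0 T :=
  (intervalIntegrable_iff_integrableOn_Ioo_of_le hT).2 (hg.integrable one_le_two)

theorem integrableOn_smul_of_contDiff {T : ℝ} {φ : ℝ → ℝ} (hφ : Continuous φ)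
    (hc : HasCompactSupport φ) {g : ℝ → X} (hg : IntegrableOn g (Ioo 0 T)) :
    IntegrableOn (fun t => φ t • g t) (Ioo 0 T) := by
  obtain ⟨C, hC⟩ := hc.exists_bound_of_continuous hφ
  exact Integrable.bdd_smul hg C hφ.aestronglyMeasurable (Eventually.of_forall hC)

theorem continuousOn_primitive_Icc {T : ℝ} (hT : 0 ≤ T) {g : ℝ → X}
    (hg : IntervalIntegrable g volume 0 T) :
    ContinuousOn (fun t => ∫ r in 0..t, g r) (Icc 0 T) := by
  have := intervalIntegral.continuousOn_primitive_interval' hg left_mem_uIcc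
  rwa [uIcc_of_le hT] at this

/-- A primitive has the integrand as its weak derivative. -/
theorem hasWeakDerivOn_of_integral_eq [CompleteSpace X] {T : ℝ} (hT : 0 ≤ T) {F G g : ℝ → X}
    (hg : IntervalIntegrable g volume 0 T)
    (hFG : ∀ᵐ t ∂(volume.restrict (Ioo 0 T)), G t = F t)
    (hG : ∀ t ∈ Icc 0 T, G t = G 0 + ∫ r in 0..t, g r) : HasWeakDerivOn T F g := by
  intro φ hφ hc hs
  have hgi : IntegrableOn g (Ioo 0 T) := (intervalIntegrable_iff_integrableOn_Ioo_of_le hT).1 hg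
  have hφ' : Continuous (deriv φ) := hφ.continuous_deriv (by exact_mod_cast le_top)
  have hGc : ContinuousOn G (Icc 0 T) :=
    (continuousOn_const.add (continuousOn_primitive_Icc hT hg)).congr hG
  have hGi : IntegrableOn G (Ioo 0 T) :=
    hGc.integrableOn_Icc.mono_set Ioo_subset_Icc_self
  have e1 : ∫ t in Ioo 0 T, deriv φ t • F t = ∫ t in Ioo 0 T, deriv φ t • G t := by
    refine integral_congr_ae ?_
    filter_upwards [hFG] with t ht
    rw [ht]
  -- Continuous functionals reduce the identity to scalar integration by parts.
  rw [e1, SeparatingDual.eq_iff_forall_dual_eq (R := ℝ)]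
  intro L
  rw [map_neg, ← L.integral_comp_comm (integrableOn_smul_of_contDiff hφ' hc.deriv hGi),
    ← L.integral_comp_comm (integrableOn_smul_of_contDiff hφ.continuous hc hgi)]
  simp only [map_smul, smul_eq_mul]
  have hLg : IntervalIntegrable (fun t => L (g t)) volume 0 T := 
    ⟨L.integrable_comp hg.1, L.integrable_comp hg.2⟩
  rw [← integral_deriv_mul_primitive (c := L (G 0)) hT hφ hs hLg]
  refine setIntegral_congr_fun measurableSet_Ioo fun t ht => ?_
  have ht' := Ioo_subset_Icc_self ht
  rw [hG t ht', map_add, L.intervalIntegral_comp_comm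
    (hg.mono_set (by rw [uIcc_of_le hT, uIcc_of_le ht'.1]; exact Icc_subset_Icc_right ht'.2))]

/-- A test function with vanishing integral is the derivative of a test function. -/
theorem exists_deriv_eq_of_integral_eq_zero {T : ℝ} (hT : 0 < T) {θ : ℝ → ℝ} (hθ : ContDiff ℝ ∞ θ)
    (hc : HasCompactSupport θ) (hs : tsupport θ ⊆ Ioo 0 T) (h0 : ∫ t in Ioo 0 T, θ t = 0) :
    ∃ φ : ℝ → ℝ, ContDiff ℝ ∞ φ ∧ HasCompactSupport φ ∧ tsupport φ ⊆ Ioo 0 T ∧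
      deriv φ = θ := by
  -- `T / 2` only ensures that the compact set is nonempty, so that it has a least and a greatest
  -- element.
  have hK : IsCompact (insert (T / 2) (tsupport θ)) := hc.isCompact.insert _
  have hKne : (insert (T / 2) (tsupport θ)).Nonempty := ⟨_, mem_insert _ _⟩
  have hKs : insert (T / 2) (tsupport θ) ⊆ Ioo 0 T :=
    insert_subset ⟨by linarith, by linarith⟩ hs
  obtain ⟨c, hcK, hcl⟩ := hK.exists_isLeast hKne
  obtain ⟨d, hdK, hdg⟩ := hK.exists_isGreatest hKne
  have hc0 := (hKs hcK).1
  have hdT := (hKs hdK).2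
  have hlt : ∀ t < c, θ t = 0 := fun t ht =>
    image_eq_zero_of_notMem_tsupport fun h => absurd (hcl (mem_insert_of_mem _ h)) (not_le.2 ht)
  have hgt : ∀ t, d < t → θ t = 0 := fun t ht =>
    image_eq_zero_of_notMem_tsupport fun h => absurd (hdg (mem_insert_of_mem _ h)) (not_le.2 ht)
  have hder : ∀ t, HasDerivAt (fun t => ∫ r in 0..t, θ r) (θ t) t := fun t =>
    hθ.continuous.integral_hasStrictDerivAt 0 t |>.hasDerivAt
  have hd : deriv (fun t => ∫ r in 0..t, θ r) = θ := funext fun t => (hder t).deriv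
  have hsupp : Function.support (fun t => ∫ r in 0..t, θ r) ⊆ Icc c d := by
    intro t ht
    by_contra hn
    apply ht
    rcases lt_or_ge t c with h | h
    · refine intervalIntegral.integral_zero_ae (Eventually.of_forall fun r hr => hlt r ?_)
      exact ((uIoc_subset_uIcc hr).2).trans_lt (max_lt hc0 h)
    · have htd : d < t := lt_of_not_ge fun h' => hn ⟨h, h'⟩
      have e : ∫ r in 0..T, θ r = 0 := by
        rw [intervalIntegral.integral_of_le hT.le, integral_Ioc_eq_integral_Ioo, h0]
      have := intervalIntegral.integral_add_adjacent_intervals (μ := volume)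
        (hθ.continuous.intervalIntegrable 0 T) (hθ.continuous.intervalIntegrable T t)
      simp only
      rw [← this, e, zero_add]
      refine intervalIntegral.integral_zero_ae (Eventually.of_forall fun r hr => hgt r ?_)
      exact (lt_min hdT htd).trans_le (uIoc_subset_uIcc hr).1
  have hts := closure_minimal hsupp isClosed_Icc
  refine ⟨fun t => ∫ r in 0..t, θ r, ?_, ?_, hts.trans (Icc_subset_Ioo hc0 hdT), hd⟩
  · rw [contDiff_infty_iff_deriv, hd]
    exact ⟨fun t => (hder t).differentiableAt, hθ⟩
  · exact HasCompactSupport.of_support_subset_isCompact isCompact_Icc hsupp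

/-- **Du Bois-Reymond**: a continuous function with vanishing weak derivative is constant. -/
theorem eq_of_hasWeakDerivOn_zero [CompleteSpace X] {T : ℝ} (hT : 0 < T) {K : ℝ → X}
    (hK : ContinuousOn K (Icc 0 T))
    (h : ∀ φ : ℝ → ℝ, ContDiff ℝ ∞ φ → HasCompactSupport φ → tsupport φ ⊆ Ioo 0 T →
      ∫ t in Ioo 0 T, deriv φ t • K t = 0) : ∀ t ∈ Icc 0 T, K t = K 0 := by
  have hmid : T / 2 ∈ Ioo 0 T := ⟨by linarith, by linarith⟩
  have hKi : IntegrableOn K (Ioo 0 T) := hK.integrableOn_Icc.mono_set Ioo_subset_Icc_self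
  have hset : ∀ {f : ℝ → ℝ}, tsupport f ⊆ Ioo 0 T → ∫ t in Ioo 0 T, f t = ∫ t, f t :=
    fun hf => setIntegral_eq_integral_of_forall_compl_eq_zero fun t ht =>
      eq_zero_of_tsupport_subset_Ioo hf ht
  obtain ⟨η, hηs, hηc, hη, hηr, hη1⟩ :=
    exists_contDiff_tsupport_subset (n := ⊤) (isOpen_Ioo.mem_nhds hmid)
  have hη' : ContDiff ℝ ∞ η := hη
  set I := ∫ t in Ioo 0 T, η t with hI
  have hIpos : 0 < I := by
    rw [hI, hset hηs]
    exact hη.continuous.integral_pos_of_hasCompactSupport_nonneg_nonzero hηc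
      (fun t => (hηr (mem_range_self t)).1) (x := T / 2) (by rw [hη1]; exact one_ne_zero)
  -- The candidate constant is the average of `K` with weight `η / I`.
  set c : X := I⁻¹ • ∫ t in Ioo 0 T, η t • K t with hc
  have hint : ∀ {f : ℝ → ℝ}, Continuous f → HasCompactSupport f → IntegrableOn f (Ioo 0 T) :=
    fun hf hf' => (hf.integrable_of_hasCompactSupport hf').integrableOn
  have hzero : ∀ᵐ t ∂(volume.restrict (Ioo 0 T)), t ∈ Ioo 0 T → K t - c = 0 := by
    refine isOpen_Ioo.ae_eq_zero_of_integral_contDiff_smul_eq_zero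
      (f := fun t => K t - c) ?_ fun ψ hψ hψc hψs => ?_
    · have : IntegrableOn (fun t => K t - c) (Ioo 0 T) := hKi.sub (integrableOn_const (by simp))
      exact (Integrable.locallyIntegrable this).locallyIntegrableOn _
    · set J := ∫ t in Ioo 0 T, ψ t with hJ
      have hJη : ContDiff ℝ ∞ (fun t => (J / I) • η t) := hη'.const_smul _
      -- Subtracting `(J / I) • η` makes the integral of `ψ` vanish, so the difference is the
      -- derivative of a test function.
      have hθ : ContDiff ℝ ∞ (fun t => ψ t - (J / I) • η t) := hψ.sub hJη
      have hJηc : HasCompactSupport (fun t => (J / I) • η t) := hηc.smul_left (f := fun _ => J / I)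
      have hJηs : tsupport (fun t => (J / I) • η t) ⊆ Ioo 0 T :=
        (tsupport_smul_subset_right (fun _ => J / I) η).trans hηs
      have hθc : HasCompactSupport (fun t => ψ t - (J / I) • η t) := hψc.sub hJηc
      have hθs : tsupport (fun t => ψ t - (J / I) • η t) ⊆ Ioo 0 T :=
        (tsupport_sub ψ _).trans (union_subset hψs hJηs)
      have hθ0 : ∫ t in Ioo 0 T, (ψ t - (J / I) • η t) = 0 := by
        rw [integral_sub (hint hψ.continuous hψc) (hint hJη.continuous hJηc),
          integral_smul, ← hI, ← hJ, smul_eq_mul, div_mul_cancel₀ _ hIpos.ne', sub_self]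
      obtain ⟨φ, hφ, hφc, hφs, hφd⟩ := exists_deriv_eq_of_integral_eq_zero hT hθ hθc hθs hθ0
      have h1 := h φ hφ hφc hφs
      simp only [hφd, sub_smul, smul_assoc] at h1
      have iψ := integrableOn_smul_of_contDiff hψ.continuous hψc hKi
      have iη := integrableOn_smul_of_contDiff hη'.continuous hηc hKi
      have iη' : Integrable (fun t => (J / I) • η t • K t) (volume.restrict (Ioo 0 T)) :=
        Integrable.smul (J / I) iη
      rw [integral_sub iψ iη', integral_smul] at h1
      simp only [smul_sub]
      rw [integral_sub iψ ((hint hψ.continuous hψc).smul_const c), integral_smul_const, ← hJ, hc,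
        smul_smul, ← div_eq_mul_inv]
      exact h1
  have hae : K =ᵐ[volume.restrict (Icc 0 T)] fun _ => c := by
    rw [← restrict_Ioo_eq_restrict_Icc]
    filter_upwards [hzero, ae_restrict_mem measurableSet_Ioo] with t h1 h2
    exact sub_eq_zero.1 (h1 h2)
  have heq := Measure.eqOn_Icc_of_ae_eq volume hT.ne hae hK continuousOn_const
  intro t ht
  rw [heq ht, heq ⟨le_rfl, hT.le⟩]

/-- A continuous representative is the primitive of its weak derivative. -/
theorem integral_eq_of_hasWeakDerivOn [CompleteSpace X] {T : ℝ} (hT : 0 < T) {F G g : ℝ → X}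
    (hg : IntervalIntegrable g volume 0 T) (hG : ContinuousOn G (Icc 0 T))
    (hFG : ∀ᵐ t ∂(volume.restrict (Ioo 0 T)), G t = F t) (hF : HasWeakDerivOn T F g) :
    ∀ t ∈ Icc 0 T, G t = G 0 + ∫ r in 0..t, g r := by
  have hPc := continuousOn_primitive_Icc hT.le hg
  have hconst := eq_of_hasWeakDerivOn_zero hT (K := fun t => G t - ∫ r in 0..t, g r)
    (hG.sub hPc) fun φ hφ hc hs => by
      have h1 := hF φ hφ hc hs
      have h2 := hasWeakDerivOn_of_integral_eq hT.le (F := fun t => ∫ r in 0..t, g r)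
        (G := fun t => ∫ r in 0..t, g r) hg (Eventually.of_forall fun _ => rfl)
        (fun t _ => by simp) φ hφ hc hs
      have e1 : ∫ t in Ioo 0 T, deriv φ t • F t = ∫ t in Ioo 0 T, deriv φ t • G t := by
        refine integral_congr_ae ?_
        filter_upwards [hFG] with t ht
        rw [ht]
      have hφ' : Continuous (deriv φ) := hφ.continuous_deriv (by exact_mod_cast le_top)
      simp only [smul_sub]
      rw [integral_sub, ← e1, h1, h2, sub_self]
      · exact integrableOn_smul_of_contDiff hφ' hc.deriv
          (hG.integrableOn_Icc.mono_set Ioo_subset_Icc_self)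
      · exact integrableOn_smul_of_contDiff hφ' hc.deriv
          (hPc.integrableOn_Icc.mono_set Ioo_subset_Icc_self)
  intro t ht
  have := hconst t ht
  simp only [intervalIntegral.integral_same, sub_zero] at this
  rw [← this]
  abel

end WeakDerivative

/-! ### Gluing trajectories and controls. -/

section Concatenation

/-- Follow `f` up to the time `T` and then `g`, started at time `T`. -/
noncomputable def glue {X : Type*} (T : ℝ) (f g : ℝ → X) (t : ℝ) : X :=
  if t < T then f t else g (t - T)

theorem glue_of_lt {X : Type*} {T t : ℝ} (f g : ℝ → X) (h : t < T) : glue T f g t = f t :=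
  if_pos h

theorem glue_of_le {X : Type*} {T t : ℝ} (f g : ℝ → X) (h : T ≤ t) :
    glue T f g t = g (t - T) :=
  if_neg (not_lt.2 h)

/-- The switching time is a null set; excluding it keeps both alternatives inside the open
intervals. -/
theorem ae_restrict_glue {T s : ℝ} {P Q : ℝ → Prop}
    (hP : ∀ᵐ t ∂(volume.restrict (Ioo 0 T)), P t) (hQ : ∀ᵐ t ∂(volume.restrict (Ioo 0 s)), Q t) :
    ∀ᵐ t ∂(volume.restrict (Ioo 0 (T + s))), t < T ∧ P t ∨ T < t ∧ Q (t - T) := by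
  rw [ae_restrict_iff' measurableSet_Ioo] at hP hQ ⊢
  have hQ' : ∀ᵐ t, t - T ∈ Ioo 0 s → Q (t - T) :=
    (measurePreserving_sub_right volume T).quasiMeasurePreserving.ae hQ
  have hne : ∀ᵐ t : ℝ, t ≠ T := compl_mem_ae_iff.2 (measure_singleton T)
  filter_upwards [hP, hQ', hne] with t h1 h2 h3 ht
  rcases lt_or_gt_of_ne h3 with h | h
  · exact Or.inl ⟨h, h1 ⟨ht.1, h⟩⟩
  · exact Or.inr ⟨h, h2 ⟨sub_pos.2 h, by linarith [ht.2]⟩⟩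

theorem memLp_glue {X : Type*} [NormedAddCommGroup X] {T s : ℝ} (hT : 0 < T) (hs : 0 < s)
    {p : ℝ≥0∞} {f g : ℝ → X} (hf : MemLp f p (volume.restrict (Ioo 0 T)))
    (hg : MemLp g p (volume.restrict (Ioo 0 s))) :
    MemLp (glue T f g) p (volume.restrict (Ioo 0 (T + s))) := by
  classical
  have h : MemLp ((Iio T).piecewise f fun t => g (t - T)) p (volume.restrict (Ioo 0 (T + s))) := by
    refine MemLp.piecewise measurableSet_Iio ?_ ?_
    · rw [Measure.restrict_restrict measurableSet_Iio]
      have : Iio T ∩ Ioo 0 (T + s) = Ioo 0 T := by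
        ext t
        simp only [mem_inter_iff, mem_Iio, mem_Ioo]
        constructor
        · rintro ⟨h1, h2, -⟩; exact ⟨h2, h1⟩
        · rintro ⟨h1, h2⟩; exact ⟨h2, h1, by linarith⟩
      rwa [this]
    · rw [Measure.restrict_restrict measurableSet_Iio.compl]
      have e1 : (Iio T)ᶜ ∩ Ioo 0 (T + s) = (fun t => t - T) ⁻¹' Ico 0 s := by
        ext t
        simp only [mem_inter_iff, mem_compl_iff, mem_Iio, mem_Ioo, mem_preimage, mem_Ico, not_lt]
        constructor
        · rintro ⟨h1, -, h2⟩; constructor <;> linarith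
        · rintro ⟨h1, h2⟩; refine ⟨?_, ?_, ?_⟩ <;> linarith
      rw [e1]
      rw [restrict_Ioo_eq_restrict_Ico] at hg
      exact hg.comp_measurePreserving
        ((measurePreserving_sub_right volume T).restrict_preimage measurableSet_Ico)
  exact h

theorem continuousOn_glue {X : Type*} [TopologicalSpace X] {T s : ℝ} (hT : 0 ≤ T) (hs : 0 ≤ s)
    {f g : ℝ → X} (hf : ContinuousOn f (Icc 0 T)) (hg : ContinuousOn g (Icc 0 s))
    (h : f T = g 0) : ContinuousOn (glue T f g) (Icc 0 (T + s)) := by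
  rw [← Icc_union_Icc_eq_Icc hT (le_add_of_nonneg_right hs)]
  refine ContinuousOn.union_of_isClosed ?_ ?_ isClosed_Icc isClosed_Icc
  · refine hf.congr fun t ht => ?_
    rcases ht.2.lt_or_eq with h' | rfl
    · exact glue_of_lt f g h'
    · rw [glue_of_le f g le_rfl, sub_self, h]
  · have : ContinuousOn (fun t => g (t - T)) (Icc T (T + s)) :=
      hg.comp (continuous_sub_right T).continuousOn fun t ht =>
        ⟨sub_nonneg.2 ht.1, by linarith [ht.2]⟩
    exact this.congr fun t ht => glue_of_le f g ht.1

theorem intervalIntegral_glue_of_le {X : Type*} [NormedAddCommGroup X] [NormedSpace ℝ X]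
    {T t : ℝ} (h0 : 0 ≤ t) (ht : t ≤ T) (f g : ℝ → X) :
    ∫ r in 0..t, glue T f g r = ∫ r in 0..t, f r := by
  rw [intervalIntegral.integral_of_le h0, intervalIntegral.integral_of_le h0,
    integral_Ioc_eq_integral_Ioo, integral_Ioc_eq_integral_Ioo]
  exact setIntegral_congr_fun measurableSet_Ioo fun r hr => glue_of_lt f g (hr.2.trans_le ht)

theorem intervalIntegral_glue_of_ge {X : Type*} [NormedAddCommGroup X] [NormedSpace ℝ X]
    {T t : ℝ} (ht : T ≤ t) (f g : ℝ → X) :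
    ∫ r in T..t, glue T f g r = ∫ r in 0..(t - T), g r := by
  have h := intervalIntegral.integral_comp_sub_right g T (a := T) (b := t)
  rw [sub_self] at h
  rw [← h]
  refine intervalIntegral.integral_congr fun r hr => ?_
  rw [uIcc_of_le ht] at hr
  exact glue_of_le f g hr.1

variable {V H Ω : Type*}
  [NormedAddCommGroup V] [InnerProductSpace ℝ V]
  [NormedAddCommGroup H] [InnerProductSpace ℝ H]
  [MeasurableSpace Ω]

/-- A trajectory may be continued with a constant control. -/
theorem IsTrajectory.glue {ι : V →L[ℝ] H} {a : V →L[ℝ] V →L[ℝ] ℝ} {ρ : Measure Ω}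
    {B : Lp ℝ 2 ρ →L[ℝ] StrongDual ℝ V} {y₀ : H} {T s : ℝ} (hT : 0 < T) (hs : 0 < s)
    {u : ℝ → Lp ℝ 2 ρ} {Y : ℝ → H} (hY : IsTrajectory ι a B y₀ T u Y)
    {w : V} {k : Lp ℝ 2 ρ} (hw : a w = B k) {v : ℝ → V} {Z : ℝ → H}
    (hZ : IsIntegrated ι a s v Z) (hZ0 : Z 0 = Y T - ι w) :
    IsTrajectory ι a B y₀ (T + s) (glue T u fun _ => k) (glue T Y fun r => Z r + ι w) := by
  obtain ⟨y, y', hW, hC, hE, h0⟩ := hY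
  have hTs : 0 < T + s := add_pos hT hs
  have hav : MemLp (fun r => -(a (v r))) 2 (volume.restrict (Ioo 0 s)) :=
    (a.comp_memLp' hZ.memLp).neg
  have hdL := memLp_glue hT hs hW.memLp_deriv hav
  have hdI := intervalIntegrable_of_memLp hTs.le hdL
  have hae : ∀ᵐ t ∂(volume.restrict (Ioo 0 (T + s))),
      TimeOptimal.glue T Y (fun r => Z r + ι w) t
        = ι (TimeOptimal.glue T y (fun r => v r + w) t) := by
    filter_upwards [ae_restrict_glue hC.ae_eq hZ.contRep.ae_eq] with t ht
    rcases ht with ⟨h1, h2⟩ | ⟨h1, h2⟩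
    · rw [glue_of_lt _ _ h1, glue_of_lt _ _ h1, h2]
    · rw [glue_of_le _ _ h1.le, glue_of_le _ _ h1.le, h2, map_add]
  have hY0 : TimeOptimal.glue T Y (fun r => Z r + ι w) 0 = Y 0 := glue_of_lt _ _ hT
  -- In integrated form the two pieces add up across `T`; the weak formulation is recovered
  -- afterwards from the glued primitive.
  have hrep : ∀ t ∈ Icc 0 T, toDual ι (Y t) = toDual ι (Y 0) + ∫ r in 0..t, y' r :=
    integral_eq_of_hasWeakDerivOn hT (F := fun t => toDual ι (ι (y t)))
      (G := fun t => toDual ι (Y t))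
      (intervalIntegrable_of_memLp hT.le hW.memLp_deriv)
      ((toDualL ι).continuous.comp_continuousOn hC.continuousOn)
      (hC.ae_eq.mono fun t ht => by rw [ht]) hW.weakDeriv
  refine ⟨TimeOptimal.glue T y fun r => v r + w,
    TimeOptimal.glue T y' fun r => -(a (v r)), ⟨?_, hdL, ?_⟩, ⟨?_, hae⟩, ?_, ?_⟩
  · exact memLp_glue hT hs hW.memLp (hZ.memLp.add (memLp_const w))
  · refine hasWeakDerivOn_of_integral_eq hTs.le
      (G := fun t => toDual ι (TimeOptimal.glue T Y (fun r => Z r + ι w) t)) hdI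
      (hae.mono fun t ht => by rw [ht]) fun t ht => ?_
    simp only [hY0]
    rcases lt_or_ge t T with h | h
    · rw [glue_of_lt _ _ h, intervalIntegral_glue_of_le ht.1 h.le]
      exact hrep t ⟨ht.1, h.le⟩
    · have hi1 := hdI.mono_set (c := 0) (d := T) (by
        rw [uIcc_of_le hT.le, uIcc_of_le hTs.le]; exact Icc_subset_Icc_right (by linarith))
      have hi2 := hdI.mono_set (c := T) (d := t) (by
        rw [uIcc_of_le h, uIcc_of_le hTs.le]; exact Icc_subset_Icc hT.le ht.2)
      rw [glue_of_le _ _ h, ← intervalIntegral.integral_add_adjacent_intervals hi1 hi2,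
        intervalIntegral_glue_of_le hT.le le_rfl, intervalIntegral_glue_of_ge h,
        ← add_assoc, ← hrep T ⟨hT.le, le_rfl⟩, toDual_add,
        hZ.integral_eq (t - T) ⟨sub_nonneg.2 h, by linarith [ht.2]⟩, hZ0, toDual_sub,
        intervalIntegral.integral_neg]
      abel
  · exact continuousOn_glue hT.le hs.le hC.continuousOn
      (hZ.contRep.continuousOn.add continuousOn_const) (by rw [hZ0]; abel)
  · filter_upwards [ae_restrict_glue hE (Eventually.of_forall (p := fun _ => True) fun _ =>
      trivial)] with t ht
    rcases ht with ⟨h1, h2⟩ | ⟨h1, -⟩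
    · rw [glue_of_lt _ _ h1, glue_of_lt _ _ h1, glue_of_lt _ _ h1, h2]
    · rw [glue_of_le _ _ h1.le, glue_of_le _ _ h1.le, glue_of_le _ _ h1.le, ← hw]
      simp only [opA, map_add]
      abel
  · rw [hY0, h0]

theorem glue_mem_UadTime {ρ : Measure Ω} {ua ub : Ω → ℝ} {T s : ℝ} (hT : 0 < T) (hs : 0 < s)
    {u : ℝ → Lp ℝ 2 ρ} (hu : u ∈ UadTime ρ ua ub T) {k : Lp ℝ 2 ρ} (hk : k ∈ Uad ρ ua ub) :
    glue T u (fun _ => k) ∈ UadTime ρ ua ub (T + s) := by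
  refine ⟨memLp_glue hT hs hu.1 (memLp_const k), ?_⟩
  filter_upwards [ae_restrict_glue hu.2 (Eventually.of_forall (p := fun _ => True) fun _ =>
      trivial)] with t ht
  rcases ht with ⟨h1, h2⟩ | ⟨h1, -⟩
  · rwa [glue_of_lt _ _ h1]
  · rwa [glue_of_le _ _ h1.le]

end Concatenation

/-! ### Feasible times and the value function. -/

section ValueFunction

variable {V H Ω : Type*}
  [NormedAddCommGroup V] [InnerProductSpace ℝ V]
  [NormedAddCommGroup H] [InnerProductSpace ℝ H]
  [MeasurableSpace Ω]

theorem feasibleTimes_mono {ι : V →L[ℝ] H} {a : V →L[ℝ] V →L[ℝ] ℝ} {ρ : Measure Ω}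
    {B : Lp ℝ 2 ρ →L[ℝ] StrongDual ℝ V} {ua ub : Ω → ℝ} {y₀ yd : H} {r r' : ℝ} (h : r ≤ r') :
    feasibleTimes ι a B ua ub y₀ yd r ⊆ feasibleTimes ι a B ua ub y₀ yd r' :=
  fun _ ⟨hT, u, hu, Y, hY, hr⟩ => ⟨hT, u, hu, Y, hY, hr.trans h⟩

/-- Continuing with a control that nearly keeps `yd` in equilibrium decreases the distance to
the target at the rate `κ`. -/
theorem add_mem_feasibleTimes [CompleteSpace V] [CompleteSpace H] {ι : V →L[ℝ] H}
    (hιd : DenseRange ι) (hι : ∀ v, ‖ι v‖ ≤ ‖v‖)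
    {a : V →L[ℝ] V →L[ℝ] ℝ} {α : ℝ} (hα : 0 < α) (ha : ∀ v, α * ‖v‖ ^ 2 ≤ a v v)
    {ρ : Measure Ω} {B : Lp ℝ 2 ρ →L[ℝ] StrongDual ℝ V} {ua ub : Ω → ℝ} {y₀ : H} {yd : V}
    {k : Lp ℝ 2 ρ} (hk : k ∈ Uad ρ ua ub) {d κ r s T : ℝ} (hd : 0 < d) (hκ0 : 0 ≤ κ)
    (hκ : ‖B k - a yd‖ + κ < α * d) (hr : d ≤ r - κ * s) (hs : 0 < s)
    (hT : T ∈ feasibleTimes ι a B ua ub y₀ (ι yd) r) :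
    T + s ∈ feasibleTimes ι a B ua ub y₀ (ι yd) (r - κ * s) := by
  obtain ⟨hT0, u, hu, Y, hY, hYr⟩ := hT
  obtain ⟨w, hw⟩ := exists_eq_of_coercive hα ha (B k)
  -- With `q = w - yd`, `Z + ι q` is the deviation of the state `Z + ι w` from `ι yd`, and `a q = B
  -- k - a yd` is the stationary defect.
  obtain ⟨v, Z, hZ, hZ0, hZs⟩ := exists_isIntegrated hιd hι hα ha (Y T - ι w) hs.le
    (q := w - yd) (M := r) hd (by rwa [map_sub, hw]) (by
      rw [map_sub, sub_add_sub_cancel]; exact hYr) hr hκ0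
  refine ⟨add_pos hT0 hs, _, glue_mem_UadTime hT0 hs hu hk, _, hY.glue hT0 hs hw hZ hZ0, ?_⟩
  rw [glue_of_le _ _ (le_add_of_nonneg_right hs.le), add_sub_cancel_left, add_sub_assoc, ← map_sub]
  exact hZs

end ValueFunction

end TimeOptimal

theorem mainTheorem5
    {V H Ω : Type*}
    [NormedAddCommGroup V] [InnerProductSpace ℝ V] [CompleteSpace V]
    [NormedAddCommGroup H] [InnerProductSpace ℝ H] [CompleteSpace H]
    [MeasurableSpace Ω] (ρ : Measure Ω)
    (ι : V →L[ℝ] H) (hι : TimeOptimal.IsGelfandTriple ι)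
    (hι_norm : ∀ v : V, ‖ι v‖ ≤ ‖v‖)
    (a : V →L[ℝ] V →L[ℝ] ℝ) (α₀ : ℝ) (hα₀ : 0 < α₀)
    (ha : TimeOptimal.Garding ι a α₀ 0)
    (B : Lp ℝ 2 ρ →L[ℝ] StrongDual ℝ V)
    (ua ub : Ω → ℝ) (hua : MemLp ua ⊤ ρ) (hub : MemLp ub ⊤ ρ)
    (hab : ∀ᵐ x ∂ρ, ua x < ub x)
    (y₀ : H) (yd : V) (δ₀ : ℝ) (hδ₀ : 0 < δ₀)
    (hfeas : (TimeOptimal.feasibleTimes ι a B ua ub y₀ (ι yd) δ₀).Nonempty)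
    (hy₀ : δ₀ < ‖y₀ - ι yd‖)
    (hu : ∃ u ∈ TimeOptimal.Uad ρ ua ub, ‖B u - TimeOptimal.opA a yd‖ < α₀ * δ₀) :
    (∀ δ ∈ Icc 0 (‖y₀ - ι yd‖ - δ₀),
      TimeOptimal.minTime ι a B ua ub y₀ (ι yd) δ₀ δ < ⊤) ∧
    TimeOptimal.LipschitzFromLeftOn
      (fun δ => (TimeOptimal.minTime ι a B ua ub y₀ (ι yd) δ₀ δ).toReal)
      (Icc 0 (‖y₀ - ι yd‖ - δ₀)) := by
  have ha' : ∀ v, α₀ * ‖v‖ ^ 2 ≤ a v v := fun v => by simpa using ha v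
  have hfin : ∀ δ ∈ Icc 0 (‖y₀ - ι yd‖ - δ₀),
      TimeOptimal.minTime ι a B ua ub y₀ (ι yd) δ₀ δ < ⊤ := by
    intro δ hδ
    obtain ⟨T, hT⟩ := hfeas
    have hT' : T ∈ TimeOptimal.feasibleTimes ι a B ua ub y₀ (ι yd) (δ₀ + δ) :=
      TimeOptimal.feasibleTimes_mono (by linarith [hδ.1]) hT
    exact (iInf₂_le T hT').trans_lt ENNReal.ofReal_lt_top
  refine ⟨hfin, ?_⟩
  obtain ⟨k, hk, hkd⟩ := hu
  change ‖B k - a yd‖ < α₀ * δ₀ at hkd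
  obtain ⟨κ, hκ0, hκ⟩ : ∃ κ, 0 < κ ∧ ‖B k - a yd‖ + κ < α₀ * δ₀ :=
    ⟨(α₀ * δ₀ - ‖B k - a yd‖) / 2, by linarith, by linarith⟩
  refine ⟨κ⁻¹, by positivity, fun δ hδ δ' hδ' hle => ?_⟩
  have hmono : TimeOptimal.minTime ι a B ua ub y₀ (ι yd) δ₀ δ
      ≤ TimeOptimal.minTime ι a B ua ub y₀ (ι yd) δ₀ δ' :=
    biInf_mono (TimeOptimal.feasibleTimes_mono (by linarith))
  have hL0 : 0 ≤ κ⁻¹ * (δ - δ') := mul_nonneg (by positivity) (sub_nonneg.2 hle)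
  have hupper : TimeOptimal.minTime ι a B ua ub y₀ (ι yd) δ₀ δ'
      ≤ TimeOptimal.minTime ι a B ua ub y₀ (ι yd) δ₀ δ + ENNReal.ofReal (κ⁻¹ * (δ - δ')) := by
    rcases hle.eq_or_lt with rfl | hlt
    · exact le_self_add
    · have hs : 0 < κ⁻¹ * (δ - δ') := mul_pos (by positivity) (sub_pos.2 hlt)
      have hκs : κ * (κ⁻¹ * (δ - δ')) = δ - δ' := mul_inv_cancel_left₀ hκ0.ne' _
      -- Moving the extra time to the left allows the infimum over `T` to be taken on the right.
      rw [← tsub_le_iff_right]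
      refine le_iInf₂ fun T hT => ?_
      rw [tsub_le_iff_right, ← ENNReal.ofReal_add hT.1.le hs.le]
      -- The final radius `δ₀ + δ'` is still at least `δ₀`, so the decay rate holds during the whole
      -- extra time.
      have h := TimeOptimal.add_mem_feasibleTimes hι.denseRange hι_norm hα₀ ha' hk hδ₀ hκ0.le hκ
        (by rw [hκs]; linarith [hδ'.1]) hs hT
      rw [hκs, show δ₀ + δ - (δ - δ') = δ₀ + δ' by ring] at h
      exact iInf₂_le _ h
  have h1 := ENNReal.toReal_mono (hfin δ' hδ').ne hmono
  have h2 := ENNReal.toReal_mono (ENNReal.add_ne_top.2 ⟨(hfin δ hδ).ne, ENNReal.ofReal_ne_top⟩)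
    hupper
  rw [ENNReal.toReal_add (hfin δ hδ).ne ENNReal.ofReal_ne_top, ENNReal.toReal_ofReal hL0] at h2
  rw [abs_of_nonneg (by linarith)]
  linarith
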